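/- Let $F:X\to V$ be a function on a nonempty finite domain $X$ of size $N$ with values in a finite linearly ordered set $V$ (the contents of the output register, with some abelian group law $+$). $F$ is accessible only through calls: quantum calls $|x,v\rangle\mapsto|x,v+F(x)\rangle$ and their inverses, and classical evaluations; each counts as one call. Write $\lg=\log_2$. A search problem on $X$ is given by a predicate $P$ on $V$, and its solutions are the $x$ with $P(F(x))$. Consider the following algorithms. * **BBHT** (parameter $\lambda$). For $m=1,\lambda,\lambda^2,\dots$, as long as $m\le 2\sqrt N$: choose an integer $0\le j<m$ uniformly at random, run Grover's algorithm with $j$ iterations, and measure; if the outcome is a solution, return it. If no outcome was a solution, return *false*. * **BCWZ** (parameter $\epsilon$). Let $T=\min(\lceil\lg\epsilon^{-1}\rceil,N)$. For each $t=1,\dots,T$ run the version of Grover's algorithm which succeeds with certainty if there are exactly $t$ solutions. Then $3T$ times run Grover's algorithm with a uniformly random integer number $0\le j<\max(1,\sqrt{N/T})$ of iterations. Return the first solution found, or *false* if none is found. * **findsol** (parameter $\epsilon$). Run BBHT up to two times and then, if no solution has been found, run BCWZ with parameter $\epsilon$. Return the first solution found, or *false* if none is found. * **minfind** (parameter $\epsilon$).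 Pick $y\in X$ uniformly at random. Repeat: run findsol with parameter $\epsilon$ to find $y'$ with $F(y')<F(y)$; if it returns an element $y'$, set $y=y'$; otherwise return $y$. **Theorem.** For every $\epsilon_0<1$ there is a constant $C$, depending only on $\epsilon_0$, such that for all $X$, $V$, $F$ as above, all $\lambda\in[8/7,\,1.31]$ and all $0<\epsilon\le\epsilon_0$: with probability at least $1-\epsilon$, minfind returns, after at most $N$ passes of its loop, an $x$ at which $F$ attains its minimum; and the expected total number of calls to $F$ made by minfind is at most $C\sqrt{N\lg\epsilon^{-1}}$. -/

import Mathlib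

open scoped ENNReal

noncomputable section

namespace QMin

/-! ### Quantum circuits with oracle access to `F : X → V` -/

/-- Basis states `|x, v, b⟩`: an argument register, a value register and one ancilla qubit. -/
abbrev Reg (X V : Type) : Type := X × V × Bool

/-- The state space of the registers. -/
abbrev State (X V : Type) [Fintype X] [Fintype V] : Type := EuclideanSpace ℂ (Reg X V)

/-- The permutation of basis states `|x, v, b⟩ ↦ |x, v + F x, b⟩`. For bit strings with bitwise
addition this is the usual XOR oracle. -/
def oraclePerm {X V : Type} [AddCommGroup V] (F : X → V) : Reg X V ≃ Reg X V where
  toFun s := (s.1, s.2.1 + F s.1, s.2.2)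
  invFun s := (s.1, s.2.1 - F s.1, s.2.2)
  left_inv s := by simp
  right_inv s := by simp

/-- A call to `F` in superposition, as a unitary operator. -/
def oracle {X V : Type} [Fintype X] [Fintype V] [AddCommGroup V] (F : X → V) :
    State X V ≃ₗᵢ[ℂ] State X V :=
  LinearIsometryEquiv.piLpCongrLeft 2 ℂ ℂ (oraclePerm F)

/-- A gate is a fixed unitary operator, a call to `F`, or an inverse call to `F`. -/
inductive Gate (X V : Type) [Fintype X] [Fintype V] : Type
  | unitary (U : State X V ≃ₗᵢ[ℂ] State X V)
  | call
  | callInv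

/-- The unitary operator that a gate performs when the oracle is `F`. -/
def Gate.op {X V : Type} [Fintype X] [Fintype V] [AddCommGroup V] (F : X → V) :
    Gate X V → (State X V ≃ₗᵢ[ℂ] State X V)
  | .unitary U => U
  | .call => oracle F
  | .callInv => (oracle F).symm

/-- The number of calls to `F` made by a gate. -/
def Gate.calls {X V : Type} [Fintype X] [Fintype V] : Gate X V → ℕ
  | .unitary _ => 0
  | .call => 1
  | .callInv => 1

/-- A circuit: a unit vector to start from and a list of gates, applied from left to right.
Nothing in it depends on `F`. -/
structure Circuit (X V : Type) [Fintype X] [Fintype V] : Type where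
  init : State X V
  norm_init : ‖init‖ = 1
  gates : List (Gate X V)

/-- The state after running a list of gates from the state `ψ`. -/
def evolve {X V : Type} [Fintype X] [Fintype V] [AddCommGroup V] (F : X → V)
    (gs : List (Gate X V)) (ψ : State X V) : State X V :=
  gs.foldl (fun φ g => g.op F φ) ψ

theorem norm_evolve {X V : Type} [Fintype X] [Fintype V] [AddCommGroup V] (F : X → V)
    (gs : List (Gate X V)) (ψ : State X V) : ‖evolve F gs ψ‖ = ‖ψ‖ := by
  induction gs generalizing ψ with
  | nil => rfl
  | cons g gs ih =>
    have h := ih (g.op F ψ)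
    rw [LinearIsometryEquiv.norm_map] at h
    exact h

/-- Measuring a unit vector in the computational basis: `i` is observed with probability
`|ψ i|²`. -/
def measurePMF {ι : Type} [Fintype ι] (ψ : EuclideanSpace ℂ ι) (h : ‖ψ‖ = 1) : PMF ι :=
  PMF.ofFintype (fun i => ENNReal.ofReal (‖ψ i‖ ^ 2)) (by
    rw [← ENNReal.ofReal_sum_of_nonneg (fun i _ => by positivity),
      ← EuclideanSpace.norm_sq_eq, h]
    simp)

/-- The distribution of the measured registers after running a circuit with oracle `F`. -/
def Circuit.outcome {X V : Type} [Fintype X] [Fintype V] [AddCommGroup V] (c : Circuit X V)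
    (F : X → V) : PMF (Reg X V) :=
  measurePMF (evolve F c.gates c.init) ((norm_evolve F c.gates c.init).trans c.norm_init)

/-- The number of calls to `F` made by a circuit. -/
def Circuit.calls {X V : Type} [Fintype X] [Fintype V] (c : Circuit X V) : ℕ :=
  (c.gates.map Gate.calls).sum

/-! ### Randomized programs that run quantum circuits -/

/-- A program with oracle access to `F : X → V`. It may toss coins, call `F` on a classical
argument, and run and measure a quantum circuit; it has no other access to `F`. -/
inductive Prog (X V : Type) [Fintype X] [Fintype V] (α : Type) : Type 1
  | ret (a : α)
  | random {ι : Type} (p : PMF ι) (k : ι → Prog X V α)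
  | eval (x : X) (k : V → Prog X V α)
  | measure (c : Circuit X V) (k : Reg X V → Prog X V α)

/-- Run `p`, then continue with `f` on its result. -/
def Prog.bind {X V : Type} [Fintype X] [Fintype V] {α β : Type} (p : Prog X V α)
    (f : α → Prog X V β) : Prog X V β :=
  match p with
  | .ret a => f a
  | .random p k => .random p (fun i => (k i).bind f)
  | .eval x k => .eval x (fun v => (k v).bind f)
  | .measure c k => .measure c (fun s => (k s).bind f)

/-- The joint distribution of the result and of the total number of calls to `F`. -/
def Prog.run {X V : Type} [Fintype X] [Fintype V] [AddCommGroup V] {α : Type} (F : X → V) :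
    Prog X V α → PMF (α × ℕ)
  | .ret a => PMF.pure (a, 0)
  | .random p k => p.bind (fun i => (k i).run F)
  | .eval x k => ((k (F x)).run F).map (fun r => (r.1, r.2 + 1))
  | .measure c k =>
      (c.outcome F).bind (fun s => ((k s).run F).map (fun r => (r.1, r.2 + c.calls)))

/-- The expected number of calls to `F` (a sum of nonnegative terms, possibly infinite). -/
def Prog.expectedCalls {X V : Type} [Fintype X] [Fintype V] [AddCommGroup V] {α : Type}
    (p : Prog X V α) (F : X → V) : ℝ≥0∞ :=
  ∑' r : α × ℕ, p.run F r * (r.2 : ℝ≥0∞)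

/-- The probability that the result of the program lies in `S`. -/
def Prog.prob {X V : Type} [Fintype X] [Fintype V] [AddCommGroup V] {α : Type}
    (p : Prog X V α) (F : X → V) (S : Set α) : ℝ≥0∞ :=
  (p.run F).toOuterMeasure {r | r.1 ∈ S}

/-- Run the given programs in order until one of them returns a result; `none` if none does. -/
def firstSome {X V : Type} [Fintype X] [Fintype V] {β : Type} :
    List (Prog X V (Option β)) → Prog X V (Option β)
  | [] => .ret none
  | p :: ps => p.bind fun
    | some b => .ret (some b)
    | none => firstSome ps

/-! ### Grover's algorithm

The search problem is to find `x` with `P (F x)`, for a known predicate `P` on values. -/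

section Algorithms

variable {X V : Type} [Fintype X] [Nonempty X] [Fintype V] [DecidableEq V] [AddCommGroup V]

/-- The uniform superposition of the `|x⟩`, tensored with `|0⟩` and with an ancilla in the state
`cos α |0⟩ + sin α |1⟩`. -/
def start (X V : Type) [Fintype X] [Fintype V] [DecidableEq V] [AddCommGroup V] (α : ℝ) :
    State X V :=
  WithLp.toLp 2 fun s =>
    if s.2.1 = 0 then
      (((if s.2.2 then Real.sin α else Real.cos α) / √(Fintype.card X : ℝ) : ℝ) : ℂ)
    else 0

theorem norm_start (α : ℝ) : ‖start X V α‖ = 1 := by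
  have hN : (Fintype.card X : ℝ) ≠ 0 := by exact_mod_cast Fintype.card_ne_zero
  have h : ‖start X V α‖ ^ 2 = 1 := by
    rw [EuclideanSpace.norm_sq_eq, Fintype.sum_prod_type]
    have key : ∀ x : X, ∑ p : V × Bool, ‖start X V α (x, p)‖ ^ 2
        = 1 / (Fintype.card X : ℝ) := by
      intro x
      rw [Fintype.sum_prod_type, Finset.sum_eq_single (0 : V)]
      · simp only [start, Fintype.sum_bool, if_true, Bool.false_eq_true, if_false,
          Complex.norm_real, Real.norm_eq_abs, sq_abs, div_pow,
          Real.sq_sqrt (Nat.cast_nonneg _)]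
        rw [← add_div, Real.sin_sq_add_cos_sq]
      · intro v _ hv
        simp [start, hv]
      · simp
    rw [Finset.sum_congr rfl (fun x _ => key x)]
    simp [hN]
  nlinarith [norm_nonneg (start X V α)]

/-- Flip the sign of the basis states `|x, v, 1⟩` with `P v`. -/
def flip (P : V → Prop) [DecidablePred P] : State X V ≃ₗᵢ[ℂ] State X V :=
  LinearIsometryEquiv.piLpCongrRight 2 fun s : Reg X V =>
    if P s.2.1 ∧ s.2.2 = true then LinearIsometryEquiv.neg ℂ else LinearIsometryEquiv.refl ℂ ℂ

/-- One Grover iteration: flip the sign of the solutions (compute `F x`, flip, uncompute `F x`),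
then apply `2|s⟩⟨s| - 1` with `s` the starting state. -/
def groverStep (P : V → Prop) [DecidablePred P] (α : ℝ) : List (Gate X V) :=
  [.call, .unitary (flip P), .callInv, .unitary (Submodule.reflection (ℂ ∙ start X V α))]

/-- Grover's algorithm with `j` iterations. For `α = π / 2` the ancilla is always `1` and this is
the original algorithm; smaller `α` multiply the amplitude of each solution by `sin α`. -/
def grover (P : V → Prop) [DecidablePred P] (α : ℝ) (j : ℕ) : Circuit X V where
  init := start X V α
  norm_init := norm_start α
  gates := (List.replicate j (groverStep P α)).flatten

/-- Run Grover's algorithm, and return its outcome if it is a solution. -/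
def groverTrial (P : V → Prop) [DecidablePred P] (α : ℝ) (j : ℕ) : Prog X V (Option X) :=
  .measure (grover P α j) fun s => .eval s.1 fun v => .ret (if P v then some s.1 else none)

/-- The original algorithm with a uniformly random integer number `0 ≤ j < m` of iterations
(it is used for `m ≥ 1` only). -/
def randomTrial (P : V → Prop) [DecidablePred P] (m : ℝ) : Prog X V (Option X) :=
  .random (PMF.uniformOfFinset (Finset.range (max ⌈m⌉₊ 1)) (by simp)) fun j =>
    groverTrial P (Real.pi / 2) j

/-- The algorithm BBHT of Boyer, Brassard, Høyer and Tapp, with cutoff: random trials with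
`m = 1, lam, lam ^ 2, …` as long as `m ≤ 2 √N`. -/
def bbht (lam : ℝ) (P : V → Prop) [DecidablePred P] : Prog X V (Option X) :=
  firstSome <|
    (List.range (⌊Real.logb lam (2 * √(Fintype.card X : ℝ))⌋₊ + 1)).map fun k =>
      randomTrial P (lam ^ k)

/-- Exact search for the case of exactly `t` solutions. Put `sin θ = √(t / N)`; the ancilla lowers
`θ` to the largest angle `π / (2 (2 j + 1)) ≤ θ`, for which `j` iterations succeed surely. -/
def exactTrial (P : V → Prop) [DecidablePred P] (t : ℕ) : Prog X V (Option X) :=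
  let θ : ℝ := Real.arcsin √((t : ℝ) / Fintype.card X)
  let j : ℕ := ⌈Real.pi / (4 * θ) - 1 / 2⌉₊
  groverTrial P (Real.arcsin (Real.sin (Real.pi / (2 * (2 * j + 1))) / Real.sin θ)) j

/-- The algorithm BCWZ of Buhrman, Cleve, de Wolf and Zalka with error parameter `ε`. With
`T = min ⌈lg ε⁻¹⌉ N`: exact searches for `1, …, T` solutions, and then `T` searches of
`O(√(N / T))` calls each for more than `T` solutions, each one made of three random trials. -/
def bcwz (ε : ℝ) (P : V → Prop) [DecidablePred P] : Prog X V (Option X) :=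
  let T : ℕ := min ⌈Real.logb 2 ε⁻¹⌉₊ (Fintype.card X)
  firstSome <|
    ((List.range T).map fun i => exactTrial P (i + 1)) ++
      List.replicate (3 * T) (randomTrial P √((Fintype.card X : ℝ) / T))

/-- findsol: run BBHT up to twice; if neither run finds a solution, run BCWZ. -/
def findsol (lam ε : ℝ) (P : V → Prop) [DecidablePred P] : Prog X V (Option X) :=
  firstSome [bbht lam P, bbht lam P, bcwz ε P]

/-- The loop of minfind from the current element `y`: use findsol to look for `y'` with
`F y' < F y`; if it returns one, set `y = y'` and repeat, otherwise return `y`. The result is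
`none` if the loop has not returned within `n` passes. -/
def minfindLoop [LinearOrder V] (lam ε : ℝ) : ℕ → X → Prog X V (Option X)
  | 0, _ => .ret none
  | n + 1, y => .eval y fun t =>
      (findsol lam ε (fun v => v < t)).bind fun
        | some y' => minfindLoop lam ε n y'
        | none => .ret (some y)

/-- minfind: start the loop from a uniformly random `y`, and watch it for `n` passes. -/
def minfind (X V : Type) [Fintype X] [Nonempty X] [Fintype V] [LinearOrder V] [AddCommGroup V]
    (lam ε : ℝ) (n : ℕ) : Prog X V (Option X) :=
  .random (PMF.uniformOfFintype X) fun y => minfindLoop lam ε n y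

end Algorithms

end QMin

end

/-! Every search used here is symmetric under permutations of the solutions, so it is described by
two numbers: its mean number `k` of calls and its failure probability `r` (`UniformSearch`).
Sequencing searches adds costs weighted by failure and multiplies failures. Grover's iteration is a
rotation in a plane, which gives `k` and `r` for a single trial, and hence for `bbht`, `bcwz` and
`findsol`.

Let `t` be the number of solutions. One run of BBHT costs O(√(N/t)) and fails with probability at
most 1/√t. Two failures in a row therefore have probability at most 1/t, and BCWZ, of cost O(√(NT)),
is rarely reached. So findsol costs O(√(NT/t)); it never fails for 1 ≤ t ≤ T, and for t > T it fails
with probability at most ε/t (`uniformSearch_findsol`).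

In minfind, `t` is the rank of the current element, and a successful pass moves to a uniform element
of smaller value. For a monotone bound on the remaining loop, this is no worse than a uniform rank
below `t`, even when `F` has ties (`sum_rank_le`). So any monotone function of the rank satisfying a
one-step inequality bounds the loop (`ev_minfindLoop_le`). For the error, that function is 0 up to
`T` and ε beyond. For the cost, it is a multiple of √(NT)(13 - 12/√(t+1)): without ties, rank t - 1
is visited with probability about 1/t and a pass costs about 1/√t of √(NT), a convergent series. -/

noncomputable section

namespace QMin

open scoped NNReal

/-! ### Expectations along programs; uniform searches -/

section Expectation

variable {X V : Type} [Fintype X] [Fintype V] [AddCommGroup V]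

/-- The expectation of `c * calls + g result`, computed along the program. -/
def Prog.ev {α : Type} (c : ℝ≥0∞) (F : X → V) : Prog X V α → (α → ℝ≥0∞) → ℝ≥0∞
  | .ret a, g => g a
  | .random p k, g => ∑' i, p i * (k i).ev c F g
  | .eval x k, g => c + (k (F x)).ev c F g
  | .measure C k, g => c * C.calls + ∑' s, C.outcome F s * (k s).ev c F g

theorem pmf_tsum_bind_mul {ι β : Type*} (p : PMF ι) (q : ι → PMF β) (f : β → ℝ≥0∞) :
    ∑' b, p.bind q b * f b = ∑' i, p i * ∑' b, q i b * f b := by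
  simp_rw [PMF.bind_apply, ← ENNReal.tsum_mul_right]
  rw [ENNReal.tsum_comm]
  simp_rw [mul_assoc, ENNReal.tsum_mul_left]

theorem pmf_tsum_pure_mul {β : Type*} (a : β) (f : β → ℝ≥0∞) :
    ∑' b, PMF.pure a b * f b = f a := by
  rw [tsum_eq_single a]
  · simp
  · intro b hb
    simp [PMF.pure_apply, hb]

theorem pmf_tsum_map_mul {ι β : Type*} (p : PMF ι) (q : ι → β) (f : β → ℝ≥0∞) :
    ∑' b, p.map q b * f b = ∑' i, p i * f (q i) := by
  simp_rw [← PMF.bind_pure_comp, pmf_tsum_bind_mul, Function.comp_apply, pmf_tsum_pure_mul]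

theorem pmf_tsum_mul_add_const {ι : Type*} (p : PMF ι) (a : ℝ≥0∞) (f : ι → ℝ≥0∞) :
    ∑' i, p i * (a + f i) = a + ∑' i, p i * f i := by
  simp_rw [mul_add]
  rw [ENNReal.tsum_add, ENNReal.tsum_mul_right, p.tsum_coe, one_mul]

theorem Prog.ev_eq_tsum {α : Type} (c : ℝ≥0∞) (F : X → V) (p : Prog X V α)
    (g : α → ℝ≥0∞) : p.ev c F g = ∑' r : α × ℕ, p.run F r * (c * r.2 + g r.1) := by
  induction p with
  | ret a => simp [Prog.ev, Prog.run]
  | random p k ih => simp_rw [Prog.ev, Prog.run, pmf_tsum_bind_mul, ih]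
  | eval x k ih =>
    rw [Prog.ev, Prog.run, pmf_tsum_map_mul, ih, ← pmf_tsum_mul_add_const]
    refine tsum_congr fun r => ?_
    push_cast
    ring
  | measure C k ih =>
    rw [Prog.ev, Prog.run, pmf_tsum_bind_mul, ← pmf_tsum_mul_add_const]
    refine tsum_congr fun s => ?_
    rw [pmf_tsum_map_mul, ih, ← pmf_tsum_mul_add_const]
    congr 1
    refine tsum_congr fun r => ?_
    push_cast
    ring

/-- The reason for letting `g` be arbitrary in `Prog.ev`: the expectation of the continuation is
itself such a `g`, so joint distributions of result and cost never have to be handled. -/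
theorem Prog.ev_bind {α β : Type} (c : ℝ≥0∞) (F : X → V) (p : Prog X V α)
    (f : α → Prog X V β) (g : β → ℝ≥0∞) :
    (p.bind f).ev c F g = p.ev c F fun a => (f a).ev c F g := by
  induction p with
  | ret a => rfl
  | random p k ih => simp_rw [Prog.bind, Prog.ev, ih]
  | eval x k ih => simp_rw [Prog.bind, Prog.ev, ih]
  | measure C k ih => simp_rw [Prog.bind, Prog.ev, ih]

theorem Prog.expectedCalls_eq_ev {α : Type} (p : Prog X V α) (F : X → V) :
    p.expectedCalls F = p.ev 1 F 0 := by
  simp [Prog.expectedCalls, Prog.ev_eq_tsum]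

open Classical in
theorem Prog.prob_eq_ev {α : Type} (p : Prog X V α) (F : X → V) (S : Set α) :
    p.prob F S = p.ev 0 F fun a => if a ∈ S then 1 else 0 := by
  rw [Prog.prob, PMF.toOuterMeasure_apply, Prog.ev_eq_tsum]
  refine tsum_congr fun r => ?_
  by_cases h : r.1 ∈ S <;> simp [Set.indicator, h]

/-- A search program that returns each element of `S` with the same probability, nothing else,
and `none` with probability `r`; it makes `k` calls on average. -/
def UniformSearch (F : X → V) (p : Prog X V (Option X)) (S : Finset X) (k r : ℝ≥0) : Prop :=
  ∃ w : ℝ≥0, S.card * w + r = 1 ∧ ∀ (c : ℝ≥0∞) (g : Option X → ℝ≥0∞),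
    p.ev c F g = c * k + w * ∑ x ∈ S, g (some x) + r * g none

theorem UniformSearch.le_one {F : X → V} {p : Prog X V (Option X)} {S : Finset X} {k r : ℝ≥0}
    (h : UniformSearch F p S k r) : r ≤ 1 := by
  obtain ⟨w, hw, -⟩ := h
  rw [← hw]
  exact le_add_self

theorem uniformSearch_firstSome_nil (F : X → V) (S : Finset X) :
    UniformSearch F (firstSome []) S 0 1 :=
  ⟨0, by simp, by simp [firstSome, Prog.ev]⟩

/-- The later searches run only after a failure, which has probability `r` and carries no further
information. Uniformity survives because both searches are uniform on the same `S`. -/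
theorem UniformSearch.firstSome_cons {F : X → V} {p : Prog X V (Option X)}
    {ps : List (Prog X V (Option X))} {S : Finset X} {k r k' r' : ℝ≥0}
    (h : UniformSearch F p S k r) (h' : UniformSearch F (firstSome ps) S k' r') :
    UniformSearch F (firstSome (p :: ps)) S (k + r * k') (r * r') := by
  obtain ⟨w, hw, he⟩ := h
  obtain ⟨w', hw', he'⟩ := h'
  refine ⟨w + r * w', ?_, fun c g => ?_⟩
  · calc (S.card : ℝ≥0) * (w + r * w') + r * r' = S.card * w + r * (S.card * w' + r') := by ring
      _ = 1 := by rw [hw', mul_one, hw]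
  · rw [firstSome, Prog.ev_bind, he]
    simp only [he', Prog.ev]
    push_cast
    ring

/-- A list of searches with bounds on their costs and failure probabilities. -/
theorem uniformSearch_firstSome_of_forall {F : X → V} {S : Finset X} (κ ρ : ℝ)
    (ps : List (Prog X V (Option X)))
    (h : ∀ p ∈ ps, ∃ k r : ℝ≥0, (k : ℝ) ≤ κ ∧ (r : ℝ) ≤ ρ ∧ UniformSearch F p S k r) :
    ∃ k r : ℝ≥0, (k : ℝ) ≤ ps.length * κ ∧ (r : ℝ) ≤ ρ ^ ps.length ∧
      UniformSearch F (firstSome ps) S k r := by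
  induction ps with
  | nil => exact ⟨0, 1, by simp, by simp, uniformSearch_firstSome_nil F S⟩
  | cons p ps ih =>
    obtain ⟨k, r, hk, hr, hu⟩ := h p (by simp)
    obtain ⟨k', r', hk', hr', hu'⟩ := ih fun q hq => h q (by simp [hq])
    refine ⟨_, _, ?_, ?_, hu.firstSome_cons hu'⟩
    · have h1 : (r : ℝ) ≤ 1 := by exact_mod_cast hu.le_one
      have h2 : (r : ℝ) * k' ≤ k' := mul_le_of_le_one_left k'.coe_nonneg h1
      push_cast [List.length_cons]
      linarith
    · push_cast [List.length_cons]
      rw [pow_succ']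
      exact mul_le_mul hr hr' r'.coe_nonneg (r.coe_nonneg.trans hr)

theorem UniformSearch.firstSome_append {F : X → V} {S : Finset X}
    {ps qs : List (Prog X V (Option X))} {k r k' r' : ℝ≥0}
    (h : UniformSearch F (firstSome ps) S k r) (h' : UniformSearch F (firstSome qs) S k' r') :
    UniformSearch F (firstSome (ps ++ qs)) S (k + r * k') (r * r') := by
  have key : ∀ c g, (firstSome (ps ++ qs)).ev c F g =
      (firstSome ps).ev c F fun o => match o with
        | some b => g (some b)
        | none => (firstSome qs).ev c F g := by
    intro c g
    clear h h'
    induction ps with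
    | nil => rfl
    | cons p ps ih =>
      rw [List.cons_append, firstSome, firstSome, Prog.ev_bind, Prog.ev_bind]
      congr 1
      funext o
      cases o with
      | none => exact ih
      | some b => rfl
  obtain ⟨w, hw, he⟩ := h
  obtain ⟨w', hw', he'⟩ := h'
  refine ⟨w + r * w', ?_, fun c g => ?_⟩
  · calc (S.card : ℝ≥0) * (w + r * w') + r * r' = S.card * w + r * (S.card * w' + r') := by ring
      _ = 1 := by rw [hw', mul_one, hw]
  · rw [key, he, he']
    push_cast
    ring

/-- Choosing one of finitely many searches uniformly at random. -/
theorem uniformSearch_random {F : X → V} {S : Finset X} {ι : Type} (s : Finset ι)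
    (hs : s.Nonempty) (p : ι → Prog X V (Option X)) (k r : ι → ℝ≥0)
    (h : ∀ i ∈ s, UniformSearch F (p i) S (k i) (r i)) :
    UniformSearch F (.random (PMF.uniformOfFinset s hs) p) S
      ((s.card : ℝ≥0)⁻¹ * ∑ i ∈ s, k i) ((s.card : ℝ≥0)⁻¹ * ∑ i ∈ s, r i) := by
  classical
  have hc : (s.card : ℝ≥0) ≠ 0 := by exact_mod_cast hs.card_pos.ne'
  choose! w hw he using h
  refine ⟨(s.card : ℝ≥0)⁻¹ * ∑ i ∈ s, w i, ?_, fun c g => ?_⟩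
  · calc (S.card : ℝ≥0) * ((s.card : ℝ≥0)⁻¹ * ∑ i ∈ s, w i) + (s.card : ℝ≥0)⁻¹ * ∑ i ∈ s, r i
        = (s.card : ℝ≥0)⁻¹ * ∑ i ∈ s, (S.card * w i + r i) := by
          rw [Finset.sum_add_distrib, ← Finset.mul_sum]
          ring
      _ = 1 := by
          rw [Finset.sum_congr rfl hw]
          simp [hc]
  · have hcast : (((s.card : ℝ≥0)⁻¹ : ℝ≥0) : ℝ≥0∞) = (s.card : ℝ≥0∞)⁻¹ := by
      rw [ENNReal.coe_inv hc]
      simp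
    have hev : (Prog.random (PMF.uniformOfFinset s hs) p).ev c F g
        = ∑ i ∈ s, (s.card : ℝ≥0∞)⁻¹ * (p i).ev c F g := by
      rw [Prog.ev, tsum_eq_sum (s := s)]
      · refine Finset.sum_congr rfl fun i hi => ?_
        simp [PMF.uniformOfFinset_apply, hi]
      · intro i hi
        simp [PMF.uniformOfFinset_apply, hi]
    rw [hev, Finset.sum_congr rfl fun i hi => by rw [he i hi]]
    push_cast
    rw [hcast, ← Finset.mul_sum, Finset.sum_add_distrib, Finset.sum_add_distrib,
      ← Finset.mul_sum, ← Finset.sum_mul, ← Finset.sum_mul]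
    ring

end Expectation

/-! ### Grover's algorithm as a rotation -/

section Grover

theorem evolve_append {X V : Type} [Fintype X] [Fintype V] [AddCommGroup V] (F : X → V)
    (gs hs : List (Gate X V)) (ψ : State X V) :
    evolve F (gs ++ hs) ψ = evolve F hs (evolve F gs ψ) := List.foldl_append

variable {X V : Type} [Fintype X] [Fintype V] [DecidableEq V] [AddCommGroup V]

/-- The starting state with the amplitudes of the solutions (with ancilla `1`) multiplied by `A`,
and all other amplitudes multiplied by `B`. -/
def groverState (F : X → V) (P : V → Prop) [DecidablePred P] (α A B : ℝ) : State X V :=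
  WithLp.toLp 2 fun s =>
    (((if P (F s.1) ∧ s.2.2 = true then A else B) : ℝ) : ℂ) * start X V α s

theorem groverState_one (F : X → V) (P : V → Prop) [DecidablePred P] (α : ℝ) :
    groverState F P α 1 1 = start X V α := by
  ext s
  simp [groverState]

theorem start_apply (α : ℝ) (s : Reg X V) : start X V α s =
    if s.2.1 = 0 then
      (((if s.2.2 then Real.sin α else Real.cos α) / √(Fintype.card X : ℝ) : ℝ) : ℂ)
    else 0 := rfl

/-- The value register holds 0 on the support, so the call writes `F x` there, the flip reads it and
the inverse call clears it. -/
theorem callInv_flip_call (F : X → V) (P : V → Prop) [DecidablePred P] (α A B : ℝ) :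
    (oracle F).symm (flip P (oracle F (groverState F P α A B))) = groverState F P α (-A) B := by
  ext ⟨x, v, b⟩
  simp only [oracle, flip, groverState, LinearIsometryEquiv.piLpCongrLeft_symm,
    LinearIsometryEquiv.piLpCongrLeft_apply, LinearIsometryEquiv.piLpCongrRight_apply,
    Equiv.piCongrLeft'_apply, oraclePerm, Equiv.coe_fn_symm_mk, Equiv.symm_symm, Equiv.coe_fn_mk]
  by_cases hv : v = 0
  · subst hv
    by_cases hP : P (F x) ∧ b = true <;> simp [hP]
  · simp [start_apply, hv]

variable [Nonempty X]

theorem inner_start_groverState (F : X → V) (P : V → Prop) [DecidablePred P] (α A B : ℝ) :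
    inner ℂ (start X V α) (groverState F P α A B) =
      ((A * (Real.sin α ^ 2 * ((Finset.univ.filter fun x => P (F x)).card / Fintype.card X)) +
        B * (1 - Real.sin α ^ 2 *
          ((Finset.univ.filter fun x => P (F x)).card / Fintype.card X)) : ℝ) : ℂ) := by
  have hN : (Fintype.card X : ℝ) ≠ 0 := by exact_mod_cast Fintype.card_ne_zero
  have key : ∀ x : X, ∑ p : V × Bool,
      inner ℂ (start X V α (x, p)) (groverState F P α A B (x, p)) =
      (((Fintype.card X : ℝ)⁻¹ * (B + (if P (F x) then 1 else 0) *
        (Real.sin α ^ 2 * (A - B))) : ℝ) : ℂ) := by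
    intro x
    have hs : (√(Fintype.card X : ℝ)) ^ 2 = Fintype.card X := Real.sq_sqrt (Nat.cast_nonneg _)
    rw [Fintype.sum_prod_type, Finset.sum_eq_single (0 : V)]
    · by_cases hP : P (F x)
      · simp only [groverState, start_apply, Fintype.sum_bool, if_true, Bool.false_eq_true,
          if_false, hP, and_false, and_true, RCLike.inner_apply, Complex.conj_ofReal,
          ← Complex.ofReal_mul, ← Complex.ofReal_add]
        congr 1
        field_simp
        rw [hs, Real.cos_sq']
        ring
      · simp only [groverState, start_apply, Fintype.sum_bool, if_true, Bool.false_eq_true,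
          if_false, hP, false_and, RCLike.inner_apply, Complex.conj_ofReal,
          ← Complex.ofReal_mul, ← Complex.ofReal_add]
        congr 1
        field_simp
        rw [hs, Real.cos_sq']
        ring
    · intro v _ hv
      simp [start_apply, hv]
    · simp
  rw [PiLp.inner_apply, Fintype.sum_prod_type, Finset.sum_congr rfl fun x _ => key x,
    ← Complex.ofReal_sum]
  congr 1
  rw [← Finset.mul_sum, Finset.sum_add_distrib, ← Finset.sum_mul, Finset.sum_boole]
  simp only [Finset.sum_const, Finset.card_univ, nsmul_eq_mul]
  field_simp
  ring


theorem evolve_groverStep (F : X → V) (P : V → Prop) [DecidablePred P] (α A B s : ℝ)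
    (hs : s ^ 2 = Real.sin α ^ 2 *
      ((Finset.univ.filter fun x => P (F x)).card / Fintype.card X)) :
    evolve F (groverStep P α) (groverState F P α A B) =
      groverState F P α (2 * (-A * s ^ 2 + B * (1 - s ^ 2)) + A)
        (2 * (-A * s ^ 2 + B * (1 - s ^ 2)) - B) := by
  have h : evolve F (groverStep P α) (groverState F P α A B) =
      Submodule.reflection (ℂ ∙ start X V α)
        ((oracle F).symm (flip P (oracle F (groverState F P α A B)))) := rfl
  rw [h, callInv_flip_call, Submodule.reflection_apply,
    Submodule.starProjection_unit_singleton ℂ (norm_start α), inner_start_groverState, ← hs]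
  ext z
  by_cases hz : P (F z.1) ∧ z.2.2 = true
  · simp [groverState, hz]
    ring
  · simp [groverState, hz]
    ring

/-- The state after `j` iterations of Grover's algorithm. -/
theorem exists_evolve_grover (F : X → V) (P : V → Prop) [DecidablePred P] (α φ : ℝ)
    (hφ : Real.sin φ ^ 2 = Real.sin α ^ 2 *
      ((Finset.univ.filter fun x => P (F x)).card / Fintype.card X)) (j : ℕ) :
    ∃ A B : ℝ, A * Real.sin φ = Real.sin ((2 * j + 1) * φ) ∧
      B * Real.cos φ = Real.cos ((2 * j + 1) * φ) ∧
      evolve F (grover P α j : Circuit X V).gates (grover P α j : Circuit X V).init =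
        groverState F P α A B := by
  induction j with
  -- The factors sin φ and cos φ stay on the left so that angles where one of them vanishes are
  -- covered too.
  | zero => exact ⟨1, 1, by simp, by simp, (groverState_one F P α).symm⟩
  | succ j ih =>
    obtain ⟨A, B, hA, hB, hE⟩ := ih
    have hc : 1 - Real.sin φ ^ 2 = Real.cos φ ^ 2 := by rw [Real.cos_sq']
    have hsum : (2 * ((j + 1 : ℕ) : ℝ) + 1) * φ = (2 * j + 1) * φ + 2 * φ := by
      push_cast
      ring
    refine ⟨2 * (-A * Real.sin φ ^ 2 + B * (1 - Real.sin φ ^ 2)) + A,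
      2 * (-A * Real.sin φ ^ 2 + B * (1 - Real.sin φ ^ 2)) - B, ?_, ?_, ?_⟩
    · rw [hsum, Real.sin_add, ← hA, ← hB, Real.sin_two_mul, Real.cos_two_mul, Real.cos_sq']
      linear_combination 2 * B * Real.sin φ * Real.sin_sq_add_cos_sq φ * (-1)
    · rw [hsum, Real.cos_add, ← hA, ← hB, Real.sin_two_mul, Real.cos_two_mul]
      linear_combination 2 * B * Real.cos φ * Real.sin_sq_add_cos_sq φ * (-1)
    · have h1 : (grover P α (j + 1) : Circuit X V).gates =
          (grover P α j : Circuit X V).gates ++ groverStep P α := by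
        simp [grover, List.replicate_succ']
      have h2 : (grover P α (j + 1) : Circuit X V).init = (grover P α j : Circuit X V).init := rfl
      rw [h1, evolve_append, h2, hE, evolve_groverStep F P α A B (Real.sin φ) hφ]

theorem calls_grover (P : V → Prop) [DecidablePred P] (α : ℝ) (j : ℕ) :
    (grover P α j : Circuit X V).calls = 2 * j := by
  induction j with
  | zero => simp [grover, Circuit.calls]
  | succ j ih =>
    have h : ((groverStep P α : List (Gate X V)).map Gate.calls).sum = 2 := rfl
    simp only [grover, Circuit.calls] at ih
    simp only [grover, Circuit.calls, List.replicate_succ, List.flatten_cons, List.map_append,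
      List.sum_append, ih, h]
    ring

/-- Amplitudes depend on `x` only through `P (F x)`, hence uniformity. The non-solutions carry mass
B²(1 - t/N), at most B²(1 - sin²α · t/N) = cos²((2j+1)φ). The bound is an inequality because
solutions observed with ancilla 0 are accepted as well. The extra call is the classical check. -/
theorem uniformSearch_groverTrial (F : X → V) (P : V → Prop) [DecidablePred P] (α φ : ℝ)
    (hφ : Real.sin φ ^ 2 = Real.sin α ^ 2 *
      ((Finset.univ.filter fun x => P (F x)).card / Fintype.card X)) (j : ℕ) :
    ∃ r : ℝ≥0, (r : ℝ) ≤ Real.cos ((2 * j + 1) * φ) ^ 2 ∧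
      UniformSearch F (groverTrial P α j) (Finset.univ.filter fun x => P (F x))
        (2 * j + 1) r := by
  classical
  obtain ⟨A, B, -, hB, hE⟩ := exists_evolve_grover F P α φ hφ j
  have hN : (0 : ℝ) < Fintype.card X := by exact_mod_cast Fintype.card_pos
  have hsq : (√(Fintype.card X : ℝ)) ^ 2 = Fintype.card X := Real.sq_sqrt hN.le
  set S := Finset.univ.filter fun x => P (F x) with hS
  set w : ℝ≥0 :=
    ((A * Real.sin α) ^ 2 / Fintype.card X + (B * Real.cos α) ^ 2 / Fintype.card X).toNNReal
    with hw
  set v : ℝ≥0 := (B ^ 2 / Fintype.card X).toNNReal with hv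
  have hout : ∀ s, (grover P α j : Circuit X V).outcome F s =
      ENNReal.ofReal (‖groverState F P α A B s‖ ^ 2) := by
    intro s
    rw [← hE]
    rfl
  have hmarg : ∀ x, ∑ p : V × Bool, (grover P α j : Circuit X V).outcome F (x, p) =
      if x ∈ S then (w : ℝ≥0∞) else v := by
    intro x
    rw [Fintype.sum_prod_type, Finset.sum_eq_single (0 : V)]
    · simp only [hout, Fintype.sum_bool]
      rw [← ENNReal.ofReal_add (by positivity) (by positivity)]
      by_cases hP : P (F x)
      · simp only [hS, Finset.mem_filter, Finset.mem_univ, hP, and_self, if_true, hw,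
          ENNReal.ofReal, groverState, start_apply, and_false, Bool.false_eq_true, if_false,
          ← Complex.ofReal_mul, Complex.norm_real, Real.norm_eq_abs, sq_abs]
        congr 2
        field_simp
        rw [hsq]
        ring
      · simp only [hS, Finset.mem_filter, Finset.mem_univ, hP, true_and, false_and, if_true, hv,
          ENNReal.ofReal, groverState, start_apply, Bool.false_eq_true, if_false,
          ← Complex.ofReal_mul, Complex.norm_real, Real.norm_eq_abs, sq_abs]
        congr 2
        field_simp
        rw [hsq, Real.cos_sq']
        ring
    · intro v _ hv
      simp [hout, groverState, start_apply, hv]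
    · simp
  have hsplit : ∀ f : X → ℝ≥0∞,
      ∑ s : Reg X V, (grover P α j : Circuit X V).outcome F s * f s.1 =
        w * ∑ x ∈ S, f x + v * ∑ x ∈ Sᶜ, f x := by
    intro f
    rw [Fintype.sum_prod_type]
    simp only
    simp_rw [← Finset.sum_mul, hmarg]
    rw [← Finset.sum_add_sum_compl S, Finset.mul_sum, Finset.mul_sum]
    congr 1
    · exact Finset.sum_congr rfl fun x hx => by rw [if_pos hx]
    · exact Finset.sum_congr rfl fun x hx => by rw [if_neg (Finset.mem_compl.1 hx)]
  have htot : (S.card : ℝ≥0) * w + Sᶜ.card * v = 1 := by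
    have h1 := hsplit fun _ => 1
    have h2 := ((grover P α j : Circuit X V).outcome F).tsum_coe
    rw [tsum_fintype] at h2
    simp only [mul_one, h2, Finset.sum_const, nsmul_eq_mul] at h1
    have h3 : ((S.card * w + Sᶜ.card * v : ℝ≥0) : ℝ≥0∞) = ((1 : ℝ≥0) : ℝ≥0∞) := by
      push_cast
      rw [h1]
      ring
    exact_mod_cast h3
  refine ⟨Sᶜ.card * v, ?_, w, htot, fun c g => ?_⟩
  · rw [← hB, mul_pow, Real.cos_sq', hφ]
    push_cast
    rw [hv, Real.coe_toNNReal _ (by positivity), Finset.card_compl,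
      Nat.cast_sub (Finset.card_le_univ S)]
    have h1 : Real.sin α ^ 2 * (S.card / Fintype.card X : ℝ) ≤ 1 * (S.card / Fintype.card X) :=
      mul_le_mul_of_nonneg_right (Real.sin_sq_le_one α) (by positivity)
    calc ((Fintype.card X : ℝ) - S.card) * (B ^ 2 / Fintype.card X)
        = B ^ 2 * (1 - 1 * (S.card / Fintype.card X)) := by
          field_simp
      _ ≤ _ := mul_le_mul_of_nonneg_left (by linarith) (sq_nonneg B)
  · have h1 : (groverTrial P α j : Prog X V (Option X)).ev c F g =
        c * ((2 * j : ℕ) : ℝ≥0∞) + ∑' s, (grover P α j : Circuit X V).outcome F s *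
          (c + if P (F s.1) then g (some s.1) else g none) := by
      rw [groverTrial, Prog.ev, calls_grover]
      congr 1
      refine tsum_congr fun s => ?_
      rw [Prog.ev, Prog.ev]
      split_ifs <;> rfl
    rw [h1, pmf_tsum_mul_add_const, tsum_fintype,
      hsplit fun x => if P (F x) then g (some x) else g none]
    have h2 : ∑ x ∈ S, (if P (F x) then g (some x) else g none) = ∑ x ∈ S, g (some x) :=
      Finset.sum_congr rfl fun x hx => by rw [if_pos (Finset.mem_filter.1 hx).2]
    have h3 : ∑ x ∈ Sᶜ, (if P (F x) then g (some x) else g none) = Sᶜ.card * g none := by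
      rw [← nsmul_eq_mul, ← Finset.sum_const]
      refine Finset.sum_congr rfl fun x hx => if_neg fun hP => ?_
      exact Finset.mem_compl.1 hx (Finset.mem_filter.2 ⟨Finset.mem_univ _, hP⟩)
    rw [h2, h3]
    push_cast
    ring

end Grover

/-! ### Averaging over the number of iterations -/

theorem sum_cos_sq_mul (θ : ℝ) (M : ℕ) :
    (∑ j ∈ Finset.range M, Real.cos ((2 * j + 1) * θ) ^ 2) * (4 * Real.sin (2 * θ)) =
      2 * M * Real.sin (2 * θ) + Real.sin (4 * M * θ) := by
  induction M with
  | zero => simp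
  | succ M ih =>
    rw [Finset.sum_range_succ, add_mul, ih]
    have h1 : (4 * ((M + 1 : ℕ) : ℝ) * θ) = 2 * ((2 * M + 1) * θ) + 2 * θ := by
      push_cast
      ring
    have h2 : 4 * M * θ = 2 * ((2 * M + 1) * θ) - 2 * θ := by ring
    rw [h1, h2, Real.sin_add, Real.sin_sub, Real.cos_two_mul ((2 * M + 1) * θ)]
    push_cast
    ring

/-- Among the first `M` numbers of Grover iterations, the average failure probability is at most
`3 / 4` once `M` is large enough. -/
theorem sum_cos_sq_le (θ : ℝ) (h0 : 0 ≤ θ) (h1 : θ ≤ Real.pi / 2) (M : ℕ) (hM : 1 ≤ M)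
    (h : 1 ≤ 2 * (M : ℝ) ^ 2 * Real.sin θ ^ 2) :
    ∑ j ∈ Finset.range M, Real.cos ((2 * j + 1) * θ) ^ 2 ≤ 3 / 4 * M := by
  have hpi := Real.pi_pos
  have hM' : (1 : ℝ) ≤ M := by exact_mod_cast hM
  have hsum := sum_cos_sq_mul θ M
  -- The closed form of the sum can be divided by sin 2θ except at θ = π/2, where every cosine in
  -- the sum vanishes.
  suffices hs : 0 < Real.sin (2 * θ) ∧ Real.sin (4 * M * θ) ≤ M * Real.sin (2 * θ) ∨
      θ = Real.pi / 2 by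
    obtain ⟨hp, hs⟩ | rfl := hs
    · refine le_of_mul_le_mul_right ?_ (by positivity : 0 < 4 * Real.sin (2 * θ))
      rw [hsum]
      linarith
    · rw [Finset.sum_eq_zero]
      · positivity
      · intro j _
        have : Real.cos ((2 * j + 1) * (Real.pi / 2)) = 0 :=
          Real.cos_eq_zero_iff.2 ⟨j, by push_cast; ring⟩
        rw [this]
        norm_num
  rcases le_total θ (Real.pi / 4) with hθ | hθ
  · left
    have hsθ : 0 ≤ Real.sin θ := Real.sin_nonneg_of_nonneg_of_le_pi h0 (by linarith)
    have hs0 : 0 < Real.sin θ := by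
      refine lt_of_le_of_ne hsθ fun he => ?_
      rw [← he] at h
      norm_num at h
    have hc : √2 / 2 ≤ Real.cos θ := by
      rw [← Real.cos_pi_div_four]
      exact Real.cos_le_cos_of_nonneg_of_le_pi h0 (by linarith) hθ
    have hc0 : 0 < Real.cos θ := lt_of_lt_of_le (by positivity) hc
    have hc2 : 1 / 2 ≤ Real.cos θ ^ 2 := by
      have := pow_le_pow_left₀ (by positivity) hc 2
      rw [div_pow, Real.sq_sqrt (by norm_num)] at this
      linarith
    have hge : 1 ≤ M * Real.sin (2 * θ) := by
      rw [Real.sin_two_mul]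
      have : (1 : ℝ) ≤ (M * (2 * Real.sin θ * Real.cos θ)) ^ 2 := by
        calc (1 : ℝ) ≤ 2 * (M : ℝ) ^ 2 * Real.sin θ ^ 2 := h
          _ = (4 * (M : ℝ) ^ 2 * Real.sin θ ^ 2) * (1 / 2) := by ring
          _ ≤ (4 * (M : ℝ) ^ 2 * Real.sin θ ^ 2) * Real.cos θ ^ 2 := by gcongr
          _ = _ := by ring
      exact (one_le_sq_iff₀ (by positivity)).1 this
    refine ⟨?_, (Real.sin_le_one _).trans hge⟩
    rw [Real.sin_two_mul]
    positivity
  · rcases h1.eq_or_lt with he | hlt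
    · exact Or.inr he
    left
    -- Near π/2 the sine changes sign under reflection: either 4Mφ ≤ π and the left side is
    -- nonpositive, or Jordan's inequality gives M sin 2φ ≥ 4Mφ/π ≥ 1.
    obtain ⟨φ, rfl⟩ : ∃ φ, θ = Real.pi / 2 - φ := ⟨Real.pi / 2 - θ, by ring⟩
    have hφ : 0 < φ := by linarith
    have e1 : Real.sin (2 * (Real.pi / 2 - φ)) = Real.sin (2 * φ) := by
      rw [← Real.sin_pi_sub]
      congr 1
      ring
    have e2 : Real.sin (4 * M * (Real.pi / 2 - φ)) = -Real.sin (4 * M * φ) := by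
      rw [← Real.sin_nat_mul_two_pi_sub]
      congr 1
      ring
    have hj : 2 / Real.pi * (2 * φ) ≤ Real.sin (2 * φ) :=
      Real.mul_le_sin (by linarith) (by linarith)
    have hpos : 0 < Real.sin (2 * φ) := lt_of_lt_of_le (by positivity) hj
    rw [e1, e2]
    refine ⟨hpos, ?_⟩
    rcases le_total (4 * M * φ) Real.pi with hle | hle
    · have := Real.sin_nonneg_of_nonneg_of_le_pi (by positivity : 0 ≤ 4 * (M : ℝ) * φ) hle
      have : 0 ≤ M * Real.sin (2 * φ) := by positivity
      linarith
    · have h3 : 1 ≤ M * (2 / Real.pi * (2 * φ)) := by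
        rw [show M * (2 / Real.pi * (2 * φ)) = (4 * M * φ) / Real.pi by ring, one_le_div hpi]
        exact hle
      have h4 : M * (2 / Real.pi * (2 * φ)) ≤ M * Real.sin (2 * φ) := by gcongr
      linarith [Real.neg_one_le_sin (4 * M * φ)]

/-! ### Single trials -/

section Trials

variable {X V : Type} [Fintype X] [Fintype V] [DecidableEq V] [AddCommGroup V] [Nonempty X]

theorem card_filter_div_le_one (p : X → Prop) [DecidablePred p] :
    ((Finset.univ.filter p).card / Fintype.card X : ℝ) ≤ 1 :=
  div_le_one_of_le₀ (by exact_mod_cast Finset.card_le_univ _) (by positivity)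

/-- The mean of 2j + 1 over j < M is exactly M, and M = ⌈m⌉ ≤ m + 1 ≤ 3m. The condition on `m` is
the one of `sum_cos_sq_le` with sin²θ = t/N. -/
theorem uniformSearch_randomTrial (F : X → V) (P : V → Prop) [DecidablePred P] (m : ℝ)
    (hm : 1 ≤ m) :
    ∃ k r : ℝ≥0, (k : ℝ) ≤ 3 * m ∧
      ((Fintype.card X : ℝ) ≤ 2 * (Finset.univ.filter fun x => P (F x)).card * m ^ 2 →
        (r : ℝ) ≤ 3 / 4) ∧
      UniformSearch F (randomTrial P m) (Finset.univ.filter fun x => P (F x)) k r := by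
  set S := Finset.univ.filter fun x => P (F x) with hS
  have hN : (0 : ℝ) < Fintype.card X := by exact_mod_cast Fintype.card_pos
  have hq0 : (0 : ℝ) ≤ S.card / Fintype.card X := by positivity
  have hq1 : (S.card / Fintype.card X : ℝ) ≤ 1 := card_filter_div_le_one _
  set θ := Real.arcsin √(S.card / Fintype.card X : ℝ) with hθ
  have hsin : Real.sin θ = √(S.card / Fintype.card X : ℝ) :=
    Real.sin_arcsin (by linarith [Real.sqrt_nonneg (S.card / Fintype.card X : ℝ)])
      (Real.sqrt_le_one.2 hq1)
  have hsin2 : Real.sin θ ^ 2 = S.card / Fintype.card X := by rw [hsin, Real.sq_sqrt hq0]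
  have hφ : Real.sin θ ^ 2 = Real.sin (Real.pi / 2) ^ 2 * (S.card / Fintype.card X) := by
    rw [hsin2, Real.sin_pi_div_two]
    ring
  choose r hr hu using uniformSearch_groverTrial F P (Real.pi / 2) θ hφ
  set M := max ⌈m⌉₊ 1 with hM
  have hM1 : 1 ≤ M := le_max_right _ _
  have hM0 : (M : ℝ≥0) ≠ 0 := by exact_mod_cast (by omega : M ≠ 0)
  have hM0' : (0 : ℝ) < M := by exact_mod_cast hM1
  have hmM : m ≤ M := (Nat.le_ceil m).trans (Nat.cast_le.2 (le_max_left _ _))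
  have hMm : (M : ℝ) ≤ m + 1 := by
    rw [hM, Nat.cast_max]
    exact max_le (Nat.ceil_lt_add_one (by linarith)).le (by push_cast; linarith)
  have hodd : ∀ n : ℕ, ∑ j ∈ Finset.range n, (2 * (j : ℝ≥0) + 1) = n ^ 2 := by
    intro n
    induction n with
    | zero => simp
    | succ n ih =>
      rw [Finset.sum_range_succ, ih]
      push_cast
      ring
  refine ⟨_, _, ?_, ?_, uniformSearch_random (Finset.range M) ⟨0, Finset.mem_range.2 hM1⟩ _ _ _
    fun j _ => hu j⟩
  · rw [Finset.card_range, hodd, pow_two, inv_mul_cancel_left₀ hM0]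
    push_cast
    linarith
  · intro hle
    rw [Finset.card_range]
    push_cast
    have h1 : ∑ j ∈ Finset.range M, (r j : ℝ) ≤ 3 / 4 * M := by
      refine (Finset.sum_le_sum fun j _ => hr j).trans (sum_cos_sq_le θ
        (Real.arcsin_nonneg.2 (Real.sqrt_nonneg _)) (Real.arcsin_le_pi_div_two _) M hM1 ?_)
      rw [hsin2, ← mul_div_assoc, one_le_div hN]
      calc (Fintype.card X : ℝ) ≤ 2 * S.card * m ^ 2 := hle
        _ ≤ 2 * S.card * M ^ 2 :=
          mul_le_mul_of_nonneg_left (pow_le_pow_left₀ (by linarith) hmM 2)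
            (mul_nonneg zero_le_two (Nat.cast_nonneg _))
        _ = _ := by ring
    rw [inv_mul_le_iff₀ hM0']
    linarith

/-- With exactly `t` solutions the ancilla turns θ into φ' = π/(2(2j+1)), so `j` iterations end at
angle π/2. The cost is 2j + 1 ≤ π/(2θ) + 2 ≤ 2√(N/t) + 2. -/
theorem uniformSearch_exactTrial (F : X → V) (P : V → Prop) [DecidablePred P] (t : ℕ)
    (ht : 1 ≤ t) (htN : t ≤ Fintype.card X) :
    ∃ k r : ℝ≥0, (k : ℝ) ≤ 4 * √((Fintype.card X : ℝ) / t) ∧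
      ((Finset.univ.filter fun x => P (F x)).card = t → r = 0) ∧
      UniformSearch F (exactTrial P t) (Finset.univ.filter fun x => P (F x)) k r := by
  set S := Finset.univ.filter fun x => P (F x) with hS
  have hpi := Real.pi_pos
  have hN : (0 : ℝ) < Fintype.card X := by exact_mod_cast Fintype.card_pos
  have ht0 : (0 : ℝ) < t := by exact_mod_cast ht
  have htq : (t / Fintype.card X : ℝ) ≤ 1 := div_le_one_of_le₀ (by exact_mod_cast htN) hN.le
  have hq0 : (0 : ℝ) ≤ S.card / Fintype.card X := by positivity
  have hq1 : (S.card / Fintype.card X : ℝ) ≤ 1 := card_filter_div_le_one _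
  set θ := Real.arcsin √((t : ℝ) / Fintype.card X) with hθ
  have hsin : Real.sin θ = √((t : ℝ) / Fintype.card X) :=
    Real.sin_arcsin (by linarith [Real.sqrt_nonneg ((t : ℝ) / Fintype.card X)])
      (Real.sqrt_le_one.2 htq)
  have hsin0 : 0 < Real.sin θ := by
    rw [hsin]
    positivity
  have hθ0 : 0 < θ := Real.arcsin_pos.2 (by positivity)
  have hθ1 : θ ≤ Real.pi / 2 := Real.arcsin_le_pi_div_two _
  set j := ⌈Real.pi / (4 * θ) - 1 / 2⌉₊ with hj
  set φ' := Real.pi / (2 * (2 * (j : ℝ) + 1)) with hφ'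
  set α := Real.arcsin (Real.sin φ' / Real.sin θ) with hα
  -- The angle for the actual number of solutions; it is `φ'` when that number is `t`.
  set φ := Real.arcsin (Real.sin α * √(S.card / Fintype.card X : ℝ)) with hφdef
  have hprod : |Real.sin α * √(S.card / Fintype.card X : ℝ)| ≤ 1 := by
    rw [abs_mul, abs_of_nonneg (Real.sqrt_nonneg _)]
    exact mul_le_one₀ (Real.abs_sin_le_one α) (Real.sqrt_nonneg _) (Real.sqrt_le_one.2 hq1)
  have hφ : Real.sin φ ^ 2 = Real.sin α ^ 2 * (S.card / Fintype.card X) := by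
    rw [hφdef, Real.sin_arcsin (abs_le.1 hprod).1 (abs_le.1 hprod).2, mul_pow, Real.sq_sqrt hq0]
  obtain ⟨r, hr, hu⟩ := uniformSearch_groverTrial F P α φ hφ j
  have hjle : Real.pi / (4 * θ) - 1 / 2 ≤ j := Nat.le_ceil _
  have hj0 : 0 < 2 * (j : ℝ) + 1 := by positivity
  have hφθ : φ' ≤ θ := by
    rw [hφ', div_le_iff₀ (by positivity)]
    have h1 : Real.pi / (4 * θ) ≤ j + 1 / 2 := by linarith
    rw [div_le_iff₀ (by positivity)] at h1
    linarith
  have hφ'0 : 0 ≤ φ' := by positivity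
  refine ⟨_, r, ?_, ?_, hu⟩
  · have hsq : (1 : ℝ) ≤ √((Fintype.card X : ℝ) / t) :=
      Real.one_le_sqrt.2 ((one_le_div ht0).2 (by exact_mod_cast htN))
    have hinv : √((Fintype.card X : ℝ) / t) = (√((t : ℝ) / Fintype.card X))⁻¹ := by
      rw [← Real.sqrt_inv, inv_div]
    have h1 : (j : ℝ) < Real.pi / (4 * θ) - 1 / 2 + 1 := by
      refine Nat.ceil_lt_add_one ?_
      rw [sub_nonneg, div_le_div_iff₀ (by norm_num) (by positivity)]
      linarith
    have h2 : Real.pi / (4 * θ) ≤ √((Fintype.card X : ℝ) / t) := by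
      rw [hinv, ← hsin]
      have h4 : Real.sin θ ≤ θ := Real.sin_le hθ0.le
      calc Real.pi / (4 * θ) ≤ 4 / (4 * θ) := by
            gcongr
            exact Real.pi_le_four
        _ = θ⁻¹ := by field_simp
        _ ≤ (Real.sin θ)⁻¹ := by gcongr
    push_cast
    linarith
  · intro hcard
    have hsα : Real.sin α = Real.sin φ' / Real.sin θ := by
      have h1 : 0 ≤ Real.sin φ' :=
        Real.sin_nonneg_of_nonneg_of_le_pi hφ'0 (by linarith)
      have h2 : Real.sin φ' ≤ Real.sin θ :=
        Real.sin_le_sin_of_le_of_le_pi_div_two (by linarith) hθ1 hφθ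
      have h3 : 0 ≤ Real.sin φ' / Real.sin θ := by positivity
      exact Real.sin_arcsin (by linarith) (div_le_one_of_le₀ h2 hsin0.le)
    have hφe : φ = φ' := by
      rw [hφdef, hcard, ← hsin, hsα, div_mul_cancel₀ _ hsin0.ne']
      exact Real.arcsin_sin (by linarith) (by linarith)
    have hcos : Real.cos ((2 * j + 1) * φ) = 0 := by
      have : (2 * j + 1) * φ = Real.pi / 2 := by
        rw [hφe, hφ']
        field_simp
      rw [this, Real.cos_pi_div_two]
    rw [hcos] at hr
    have h0 : (r : ℝ) ≤ 0 := by simpa using hr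
    exact le_antisymm (by exact_mod_cast h0) bot_le

end Trials

/-! ### BBHT, BCWZ and findsol -/

section Search

variable {X V : Type} [Fintype X] [Fintype V] [DecidableEq V] [AddCommGroup V] [Nonempty X]

/-- Random trials with the parameters `lam ^ a, …, lam ^ (a + l - 1)`. -/
theorem uniformSearch_randomTrials (F : X → V) (P : V → Prop) [DecidablePred P] (lam : ℝ)
    (h1 : 8 / 7 ≤ lam) (h2 : lam ≤ 1.31) (l a : ℕ) :
    ∃ k r : ℝ≥0,
      UniformSearch F (firstSome ((List.range' a l).map fun i => randomTrial P (lam ^ i)))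
        (Finset.univ.filter fun x => P (F x)) k r ∧
      (k : ℝ) ≤ 24 * (lam ^ (a + l) - lam ^ a) ∧
      ((Fintype.card X : ℝ) ≤ 2 * (Finset.univ.filter fun x => P (F x)).card * (lam ^ a) ^ 2 →
        (k : ℝ) ≤ 180 * lam ^ a ∧ (r : ℝ) * lam ^ l ≤ 1) ∧
      ∀ c : ℝ, (Fintype.card X : ℝ) ≤ 2 * (Finset.univ.filter fun x => P (F x)).card * c ^ 2 →
        lam ^ a ≤ lam * c →
        (k : ℝ) ≤ 204 * (lam * c) - 24 * lam ^ a ∧ (r : ℝ) * lam ^ (a + l) ≤ lam * c := by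
  set S := Finset.univ.filter fun x => P (F x) with hS
  have hlam : 0 < lam := by linarith
  induction l generalizing a with
  | zero =>
    have hp : 0 < lam ^ a := by positivity
    refine ⟨0, 1, uniformSearch_firstSome_nil F S, by simp, fun _ => ⟨by simp; positivity, by simp⟩,
      fun c _ hc => ⟨by push_cast; linarith, by simpa using hc⟩⟩
  | succ l ih =>
    obtain ⟨k', r', hu', hk1', hk2', hk3'⟩ := ih (a + 1)
    have hp : 0 < lam ^ a := by positivity
    have hpa : 1 ≤ lam ^ a := one_le_pow₀ (by linarith)
    obtain ⟨k, r, hk, hr, hu⟩ := uniformSearch_randomTrial F P (lam ^ a) hpa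
    have hr1 : (r : ℝ) ≤ 1 := by exact_mod_cast hu.le_one
    have hr1' : (r' : ℝ) ≤ 1 := by exact_mod_cast hu'.le_one
    have hk0' : (0 : ℝ) ≤ k' := k'.coe_nonneg
    have hr0 : (0 : ℝ) ≤ r := r.coe_nonneg
    have hr0' : (0 : ℝ) ≤ r' := r'.coe_nonneg
    have hrk : (r : ℝ) * k' ≤ k' := mul_le_of_le_one_left hk0' hr1
    have hidx : a + (l + 1) = a + 1 + l := by ring
    rw [hidx]
    have hsucc : lam ^ (a + 1) = lam ^ a * lam := pow_succ _ _
    -- This is where `lam` must stay away from 1: the costs telescope as a geometric series.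
    have hgrow : 3 * lam ^ a ≤ 24 * (lam ^ (a + 1) - lam ^ a) := by
      rw [hsucc]
      nlinarith
    -- Here `lam` must be below 4/3, so that failures at rate 3/4 outweigh the growth of the cost: 3
    -- + (3/4)·180·1.31 < 180, and (3/4)·1.31 < 1.
    have hgood : (Fintype.card X : ℝ) ≤ 2 * S.card * (lam ^ a) ^ 2 →
        (k : ℝ) + r * k' ≤ 180 * lam ^ a ∧ (r : ℝ) * r' * lam ^ (l + 1) ≤ 1 := by
      intro h
      have hle : lam ^ a ≤ lam ^ (a + 1) := pow_le_pow_right₀ (by linarith) (by omega)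
      obtain ⟨hk2, hr2⟩ := hk2' (h.trans (by gcongr))
      have hr34 := hr h
      constructor
      · have h3 : (r : ℝ) * k' ≤ 3 / 4 * (180 * (lam ^ a * lam)) := by
          rw [← hsucc]
          exact mul_le_mul hr34 hk2 hk0' (by norm_num)
        nlinarith
      · have h3 : (r : ℝ) * lam ≤ 1 := by
          calc (r : ℝ) * lam ≤ 3 / 4 * 1.31 := mul_le_mul hr34 h2 hlam.le (by norm_num)
            _ ≤ 1 := by norm_num
        calc (r : ℝ) * r' * lam ^ (l + 1) = (r * lam) * (r' * lam ^ l) := by ring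
          _ ≤ 1 * 1 := mul_le_mul h3 hr2 (by positivity) (by norm_num)
          _ = 1 := one_mul 1
    refine ⟨k + r * k', r * r', ?_, ?_, ?_, ?_⟩
    · rw [List.range'_succ, List.map_cons]
      exact hu.firstSome_cons hu'
    · push_cast
      linarith
    · push_cast
      exact hgood
    · intro c hc hac
      push_cast
      -- `c` is a critical parameter. From `c` on, `hgood` applies; below it, the trial is charged
      -- to the telescoping term and the next parameter is still at most `lam * c`.
      rcases le_or_gt c (lam ^ a) with hca | hca
      · have hc0 : 0 ≤ c := by
          by_contra hneg
          nlinarith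
        obtain ⟨hg1, hg2⟩ := hgood (hc.trans (by gcongr))
        refine ⟨by linarith, ?_⟩
        calc (r : ℝ) * r' * lam ^ (a + 1 + l) = lam ^ a * (r * r' * lam ^ (l + 1)) := by ring
          _ ≤ lam ^ a * 1 := by gcongr
          _ ≤ _ := by linarith
      · obtain ⟨hg1, hg2⟩ := hk3' c hc (by
          rw [hsucc, mul_comm]
          gcongr)
        refine ⟨by linarith, le_trans ?_ hg2⟩
        have : (r : ℝ) * r' ≤ r' := mul_le_of_le_one_left hr0' hr1
        gcongr

/-- With critical parameter c = √(N/t) and parameters running up to the cutoff 2√N, the failure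
probability is at most 1.31 c/(2√N) < 1/√t. -/
theorem uniformSearch_bbht (F : X → V) (P : V → Prop) [DecidablePred P] (lam : ℝ)
    (h1 : 8 / 7 ≤ lam) (h2 : lam ≤ 1.31) :
    ∃ k r : ℝ≥0,
      UniformSearch F (bbht lam P) (Finset.univ.filter fun x => P (F x)) k r ∧
      (k : ℝ) ≤ 63 * √(Fintype.card X : ℝ) ∧
      (1 ≤ (Finset.univ.filter fun x => P (F x)).card →
        (k : ℝ) ≤ 268 * (√(Fintype.card X : ℝ) /
          √((Finset.univ.filter fun x => P (F x)).card : ℝ)) ∧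
        (r : ℝ) * √((Finset.univ.filter fun x => P (F x)).card : ℝ) ≤ 1) := by
  set S := Finset.univ.filter fun x => P (F x) with hS
  have hlam : 1 < lam := by linarith
  have hN : (1 : ℝ) ≤ Fintype.card X := by exact_mod_cast Fintype.card_pos
  have hsN : (1 : ℝ) ≤ √(Fintype.card X : ℝ) := Real.one_le_sqrt.2 hN
  set B := ⌊Real.logb lam (2 * √(Fintype.card X : ℝ))⌋₊ with hB
  have hB1 : lam ^ B ≤ 2 * √(Fintype.card X : ℝ) := by
    rw [← Real.rpow_natCast, ← Real.le_logb_iff_rpow_le hlam (by positivity)]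
    exact Nat.floor_le (Real.logb_nonneg hlam (by linarith))
  have hB2 : 2 * √(Fintype.card X : ℝ) ≤ lam ^ (B + 1) := by
    rw [← Real.rpow_natCast, ← Real.logb_le_iff_le_rpow hlam (by positivity)]
    push_cast
    exact (Nat.lt_floor_add_one _).le
  obtain ⟨k, r, hu, hk, -, hc⟩ := uniformSearch_randomTrials F P lam h1 h2 (B + 1) 0
  rw [← hS] at hc hu
  refine ⟨k, r, ?_, ?_, fun ht => ?_⟩
  · rw [bbht, List.range_eq_range']
    exact hu
  · rw [zero_add, pow_succ] at hk
    have : lam ^ B * lam ≤ 2 * √(Fintype.card X : ℝ) * 1.31 := by gcongr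
    have h0 : (0 : ℝ) < lam ^ 0 := by simp
    linarith
  · have ht' : (1 : ℝ) ≤ S.card := by exact_mod_cast ht
    have hst : (1 : ℝ) ≤ √(S.card : ℝ) := Real.one_le_sqrt.2 ht'
    have hcard : (S.card : ℝ) ≤ Fintype.card X := by exact_mod_cast Finset.card_le_univ S
    set c := √(Fintype.card X : ℝ) / √(S.card : ℝ) with hcdef
    have hc1 : 1 ≤ c := (one_le_div (by positivity)).2 (Real.sqrt_le_sqrt hcard)
    have hc2 : (Fintype.card X : ℝ) ≤ 2 * S.card * c ^ 2 := by
      rw [hcdef, div_pow, Real.sq_sqrt (by linarith), Real.sq_sqrt (by linarith)]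
      field_simp
      norm_num
    obtain ⟨hk1, hr1⟩ := hc c hc2 (by rw [pow_zero]; nlinarith)
    have hlc : lam * c ≤ 1.31 * c := by gcongr
    refine ⟨by rw [pow_zero] at hk1; linarith, ?_⟩
    rw [zero_add] at hr1
    have h3 : (r : ℝ) * (2 * √(Fintype.card X : ℝ)) ≤ 1.31 * c :=
      (mul_le_mul_of_nonneg_left hB2 r.coe_nonneg).trans (hr1.trans hlc)
    rw [hcdef, ← mul_div_assoc, le_div_iff₀ (by positivity)] at h3
    refine le_of_mul_le_mul_right ?_ (by positivity : 0 < 2 * √(Fintype.card X : ℝ))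
    linarith

theorem uniformSearch_exactTrials (F : X → V) (P : V → Prop) [DecidablePred P] (n : ℕ)
    (hn : n ≤ Fintype.card X) :
    ∃ k r : ℝ≥0,
      UniformSearch F (firstSome ((List.range n).map fun i => exactTrial P (i + 1)))
        (Finset.univ.filter fun x => P (F x)) k r ∧
      (k : ℝ) ≤ 8 * (√(Fintype.card X : ℝ) * √(n : ℝ)) ∧
      (1 ≤ (Finset.univ.filter fun x => P (F x)).card →
        (Finset.univ.filter fun x => P (F x)).card ≤ n → r = 0) := by
  set S := Finset.univ.filter fun x => P (F x) with hS
  induction n with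
  | zero => exact ⟨0, 1, uniformSearch_firstSome_nil F S, by simp, fun h h' => by omega⟩
  | succ n ih =>
    obtain ⟨k, r, hu, hk, hr⟩ := ih (by omega)
    obtain ⟨k', r', hk', hr', hu'⟩ := uniformSearch_exactTrial F P (n + 1) (by omega) hn
    rw [← hS] at hr' hu'
    have hu₂ := hu.firstSome_append (hu'.firstSome_cons (uniformSearch_firstSome_nil F S))
    have hlist : (List.range (n + 1)).map (fun i => (exactTrial P (i + 1) : Prog X V (Option X))) =
        (List.range n).map (fun i => exactTrial P (i + 1)) ++ [exactTrial P (n + 1)] := by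
      rw [List.range_succ, List.map_append, List.map_singleton]
    rw [← hlist] at hu₂
    refine ⟨_, _, hu₂, ?_, ?_⟩
    · have hr1 : (r : ℝ) ≤ 1 := by exact_mod_cast hu.le_one
      have hrk : (r : ℝ) * k' ≤ k' := mul_le_of_le_one_left k'.coe_nonneg hr1
      have hs0 : 0 < √((n + 1 : ℕ) : ℝ) := by positivity
      have hsq : √((n + 1 : ℕ) : ℝ) ^ 2 = n + 1 := by
        rw [Real.sq_sqrt (by positivity)]
        push_cast
        rfl
      have hsq' : √(n : ℝ) ^ 2 = n := Real.sq_sqrt (by positivity)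
      rw [Real.sqrt_div (by positivity)] at hk'
      have hinc : 4 * (√(Fintype.card X : ℝ) / √((n + 1 : ℕ) : ℝ)) ≤
          8 * (√(Fintype.card X : ℝ) * (√((n + 1 : ℕ) : ℝ) - √(n : ℝ))) := by
        rw [← mul_div_assoc, div_le_iff₀ hs0]
        -- With d the difference of the roots, the right side is 1 + d².
        have h2 : 1 ≤ 2 * (√((n + 1 : ℕ) : ℝ) - √(n : ℝ)) * √((n + 1 : ℕ) : ℝ) := by
          nlinarith [sq_nonneg (√((n + 1 : ℕ) : ℝ) - √(n : ℝ))]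
        have h3 := mul_le_mul_of_nonneg_left h2 (Real.sqrt_nonneg (Fintype.card X : ℝ))
        linarith
      push_cast at *
      linarith
    · intro ht htn
      rcases htn.lt_or_eq with hlt | heq
      · simp [hr ht (by omega)]
      · simp [hr' heq]

/-- The number `T` in `bcwz`. -/
def bcwzBound (X : Type) [Fintype X] (ε : ℝ) : ℕ :=
  min ⌈Real.logb 2 ε⁻¹⌉₊ (Fintype.card X)

theorem uniformSearch_bcwz (F : X → V) (P : V → Prop) [DecidablePred P] (ε : ℝ)
    (hT : 1 ≤ bcwzBound X ε) :
    ∃ k r : ℝ≥0,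
      UniformSearch F (bcwz ε P) (Finset.univ.filter fun x => P (F x)) k r ∧
      (k : ℝ) ≤ 17 * (√(Fintype.card X : ℝ) * √(bcwzBound X ε : ℝ)) ∧
      (1 ≤ (Finset.univ.filter fun x => P (F x)).card →
        (Finset.univ.filter fun x => P (F x)).card ≤ bcwzBound X ε → r = 0) ∧
      (bcwzBound X ε < (Finset.univ.filter fun x => P (F x)).card →
        (r : ℝ) ≤ (3 / 4) ^ (3 * bcwzBound X ε)) := by
  have hTN : bcwzBound X ε ≤ Fintype.card X := min_le_right _ _
  have hdef : (bcwz ε P : Prog X V (Option X)) = firstSome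
      (((List.range (bcwzBound X ε)).map fun i => exactTrial P (i + 1)) ++
        List.replicate (3 * bcwzBound X ε)
          (randomTrial P √((Fintype.card X : ℝ) / bcwzBound X ε))) := rfl
  rw [hdef]
  set T := bcwzBound X ε
  set S := Finset.univ.filter fun x => P (F x) with hS
  have hT' : (0 : ℝ) < T := by exact_mod_cast hT
  have hsq : √(T : ℝ) ^ 2 = T := Real.sq_sqrt hT'.le
  have hm : (1 : ℝ) ≤ √((Fintype.card X : ℝ) / T) :=
    Real.one_le_sqrt.2 ((one_le_div hT').2 (by exact_mod_cast hTN))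
  obtain ⟨k₁, r₁, hu₁, hk₁, hr₁⟩ := uniformSearch_exactTrials F P T hTN
  obtain ⟨k₂, r₂, hk₂, hr₂, hu₂⟩ := uniformSearch_randomTrial F P _ hm
  rw [← hS] at *
  -- For at most `T` solutions nothing is needed of the random trials except their cost.
  have hr₂' : (r₂ : ℝ) ≤ if T < S.card then 3 / 4 else 1 := by
    split_ifs with h
    · refine hr₂ ?_
      have hcard : (T : ℝ) ≤ S.card := by exact_mod_cast h.le
      rw [Real.sq_sqrt (by positivity), ← mul_div_assoc, le_div_iff₀ hT']
      have : (Fintype.card X : ℝ) * T ≤ Fintype.card X * S.card := by gcongr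
      have : (0 : ℝ) ≤ Fintype.card X * S.card := by positivity
      linarith
    · exact_mod_cast hu₂.le_one
  obtain ⟨k₃, r₃, hk₃, hr₃, hu₃⟩ := uniformSearch_firstSome_of_forall _ _
    (List.replicate (3 * T) (randomTrial P √((Fintype.card X : ℝ) / T)))
    (fun p hp => ⟨k₂, r₂, hk₂, hr₂', by rw [List.eq_of_mem_replicate hp]; exact hu₂⟩)
  rw [List.length_replicate] at hk₃ hr₃
  have hr1 : (r₁ : ℝ) ≤ 1 := by exact_mod_cast hu₁.le_one
  refine ⟨_, _, hu₁.firstSome_append hu₃, ?_, ?_, ?_⟩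
  · have h1 : (r₁ : ℝ) * k₃ ≤ k₃ := mul_le_of_le_one_left k₃.coe_nonneg hr1
    have h2 : ((3 * T : ℕ) : ℝ) * (3 * √((Fintype.card X : ℝ) / T)) =
        9 * (√(Fintype.card X : ℝ) * √(T : ℝ)) := by
      rw [Real.sqrt_div (by positivity)]
      have h0 : 0 < √(T : ℝ) := by positivity
      field_simp
      rw [hsq]
      push_cast
      ring
    push_cast at *
    linarith
  · intro h1 h2
    simp [hr₁ h1 h2]
  · intro h
    rw [if_pos h] at hr₃
    push_cast
    exact (mul_le_of_le_one_left r₃.coe_nonneg hr1).trans hr₃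

/-- One factor 1/√t from BBHT already brings the cost of BCWZ down to √(NT/t); both are needed for
the factor 1/t in the failure probability. Constants: 143 = 2·63 + 17 and 553 = 2·268 + 17. -/
theorem uniformSearch_findsol (F : X → V) (P : V → Prop) [DecidablePred P] (lam ε : ℝ)
    (h1 : 8 / 7 ≤ lam) (h2 : lam ≤ 1.31) (hT : 1 ≤ bcwzBound X ε) :
    ∃ k r : ℝ≥0,
      UniformSearch F (findsol lam ε P) (Finset.univ.filter fun x => P (F x)) k r ∧
      ((Finset.univ.filter fun x => P (F x)).card = 0 →
        (k : ℝ) ≤ 143 * (√(Fintype.card X : ℝ) * √(bcwzBound X ε : ℝ))) ∧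
      (1 ≤ (Finset.univ.filter fun x => P (F x)).card →
        (k : ℝ) ≤ 553 * (√(Fintype.card X : ℝ) * √(bcwzBound X ε : ℝ)) /
          √((Finset.univ.filter fun x => P (F x)).card : ℝ)) ∧
      (1 ≤ (Finset.univ.filter fun x => P (F x)).card →
        (Finset.univ.filter fun x => P (F x)).card ≤ bcwzBound X ε → r = 0) ∧
      (bcwzBound X ε < (Finset.univ.filter fun x => P (F x)).card →
        (r : ℝ) * (Finset.univ.filter fun x => P (F x)).card ≤
          (3 / 4) ^ (3 * bcwzBound X ε)) := by
  obtain ⟨k, r, hu, hk, ht⟩ := uniformSearch_bbht F P lam h1 h2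
  obtain ⟨k', r', hu', hk', hr', ht'⟩ := uniformSearch_bcwz F P ε hT
  set T := bcwzBound X ε
  set S := Finset.univ.filter fun x => P (F x) with hS
  have hsT : (1 : ℝ) ≤ √(T : ℝ) := Real.one_le_sqrt.2 (by exact_mod_cast hT)
  have hk0 : (0 : ℝ) ≤ k := k.coe_nonneg
  have hk0' : (0 : ℝ) ≤ k' := k'.coe_nonneg
  have hr0 : (0 : ℝ) ≤ r := r.coe_nonneg
  have hr1 : (r : ℝ) ≤ 1 := by exact_mod_cast hu.le_one
  have hrr : (r : ℝ) * r ≤ 1 := mul_le_one₀ hr1 hr0 hr1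
  have hrk : (r : ℝ) * k ≤ k := mul_le_of_le_one_left hk0 hr1
  have hNT : √(Fintype.card X : ℝ) ≤ √(Fintype.card X : ℝ) * √(T : ℝ) :=
    le_mul_of_one_le_right (Real.sqrt_nonneg _) hsT
  refine ⟨_, _, hu.firstSome_cons (hu.firstSome_cons
    (hu'.firstSome_cons (uniformSearch_firstSome_nil F S))), ?_, ?_, ?_, ?_⟩
  · intro _
    have h3 : (r : ℝ) * (r * k') ≤ k' := by
      rw [← mul_assoc]
      exact mul_le_of_le_one_left hk0' hrr
    push_cast
    linarith
  · intro h
    have hst : (1 : ℝ) ≤ √(S.card : ℝ) := Real.one_le_sqrt.2 (by exact_mod_cast h)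
    obtain ⟨hk2, hr2⟩ := ht h
    rw [← mul_div_assoc, le_div_iff₀ (by linarith)] at hk2
    rw [le_div_iff₀ (by linarith)]
    have h3 : (r : ℝ) * (r * k') * √(S.card : ℝ) ≤ k' := by
      calc (r : ℝ) * (r * k') * √(S.card : ℝ) = (r * (r * √(S.card : ℝ))) * k' := by ring
        _ ≤ k' := mul_le_of_le_one_left hk0' (mul_le_one₀ hr1 (by positivity) hr2)
    have h4 : (r : ℝ) * k * √(S.card : ℝ) ≤ k * √(S.card : ℝ) := by gcongr
    push_cast
    linarith
  · intro h3 h4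
    simp [hr' h3 h4]
  · intro h
    obtain ⟨-, hr2⟩ := ht (by omega)
    have hsq : √(S.card : ℝ) ^ 2 = S.card := Real.sq_sqrt (by positivity)
    push_cast
    calc (r : ℝ) * (r * (r' * 1)) * S.card
        = (r * √(S.card : ℝ)) * (r * √(S.card : ℝ)) * r' := by
          linear_combination (-(r : ℝ) * r * r') * hsq
      _ ≤ r' := mul_le_of_le_one_left r'.coe_nonneg (mul_le_one₀ hr2 (by positivity) hr2)
      _ ≤ _ := ht' h

end Search

/-! ### Ranks and the error exponent -/

section Rank

variable {X V : Type} [LinearOrder V]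

/-- The number of elements of `S` below `x`, summed over `x ∈ S` through a monotone function. -/
theorem sum_card_filter_lt_le (F : X → V) (h : ℕ → ℝ≥0) (hh : Monotone h) (S : Finset X) :
    ∑ x ∈ S, h (S.filter fun z => F z < F x).card ≤ ∑ i ∈ Finset.range S.card, h i := by
  classical
  -- A new element of largest value is counted below none of the others, and at most all of them lie
  -- below it.
  induction S using Finset.induction_on_max_value F with
  | empty => simp
  | insert a s ha hmax ih =>
    rw [Finset.sum_insert ha, Finset.card_insert_of_notMem ha, Finset.sum_range_succ, add_comm]
    refine add_le_add ((Finset.sum_le_sum fun x hx => le_of_eq ?_).trans ih) (hh ?_)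
    · rw [Finset.filter_insert, if_neg (not_lt.2 (hmax x hx))]
    · rw [Finset.filter_insert, if_neg (lt_irrefl _)]
      exact Finset.card_filter_le _ _

variable [Fintype X]

/-- The number of arguments at which `F` is less than at `y`. -/
def rank (F : X → V) (y : X) : ℕ := (Finset.univ.filter fun z => F z < F y).card

theorem rank_lt_card (F : X → V) (y : X) : rank F y < Fintype.card X :=
  Finset.card_lt_univ_of_notMem (x := y) (by simp)

theorem rank_lt_rank (F : X → V) {x y : X} (h : F x < F y) : rank F x < rank F y := by
  refine Finset.card_lt_card (Finset.ssubset_iff_of_subset ?_ |>.2 ⟨x, by simp [h]⟩)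
  intro z hz
  simp only [Finset.mem_filter, Finset.mem_univ, true_and] at hz ⊢
  exact hz.trans h

theorem rank_eq_zero_iff (F : X → V) (y : X) : rank F y = 0 ↔ ∀ z, F y ≤ F z := by
  simp [rank, Finset.filter_eq_empty_iff]

theorem sum_rank_le (F : X → V) (h : ℕ → ℝ≥0) (hh : Monotone h) (y : X) :
    ∑ x ∈ Finset.univ.filter (fun x => F x < F y), h (rank F x) ≤
      ∑ i ∈ Finset.range (rank F y), h i := by
  refine le_trans (le_of_eq (Finset.sum_congr rfl fun x hx => ?_)) (sum_card_filter_lt_le F h hh _)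
  rw [rank, Finset.filter_filter]
  congr 2
  ext z
  simp only [Finset.mem_filter, Finset.mem_univ, true_and] at hx ⊢
  exact ⟨fun hz => ⟨hz.trans hx, hz⟩, fun hz => hz.2⟩

end Rank

/-- Three trials per unit of `T` suffice since (3/4)³ < 1/2. The hypothesis excludes the case where
`T` was truncated to N. -/
theorem three_quarters_pow_le {X : Type} [Fintype X] {ε : ℝ} (hε : 0 < ε)
    (h : bcwzBound X ε < Fintype.card X) : (3 / 4 : ℝ) ^ (3 * bcwzBound X ε) ≤ ε := by
  have hT : bcwzBound X ε = ⌈Real.logb 2 ε⁻¹⌉₊ := by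
    rw [bcwzBound] at h ⊢
    omega
  have h1 : Real.logb 2 ε⁻¹ ≤ bcwzBound X ε := by
    rw [hT]
    exact Nat.le_ceil _
  rw [Real.logb_le_iff_le_rpow (by norm_num) (by positivity), Real.rpow_natCast] at h1
  rw [pow_mul]
  calc ((3 / 4 : ℝ) ^ 3) ^ bcwzBound X ε ≤ (2⁻¹) ^ bcwzBound X ε := by
        gcongr
        norm_num
    _ = (2 ^ bcwzBound X ε)⁻¹ := inv_pow _ _
    _ ≤ ε := inv_le_of_inv_le₀ hε h1

theorem sum_range_ite_le (T t : ℕ) (h : T < t) (e : ℝ≥0) :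
    ((∑ i ∈ Finset.range t, if i ≤ T then 0 else e : ℝ≥0) : ℝ) = (t - (T + 1)) * e := by
  obtain ⟨d, rfl⟩ := Nat.exists_eq_add_of_lt h
  rw [show T + d + 1 = (T + 1) + d by ring, Finset.sum_range_add, Finset.sum_eq_zero]
  · rw [Finset.sum_congr rfl fun i _ => if_neg (by omega)]
    simp
  · intro i hi
    exact if_pos (Nat.lt_succ_iff.1 (Finset.mem_range.1 hi))

/-! ### The loop of minfind: error and cost -/

section MinFind

variable {X V : Type} [Fintype X] [Fintype V] [LinearOrder V] [AddCommGroup V] [Nonempty X]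

/-- A bound `h` on expectations over the loop of minfind, as a function of the rank of the current
element, follows from a recursive inequality for `h`. -/
theorem ev_minfindLoop_le (F : X → V) (lam ε : ℝ) (c : ℝ≥0) (g : Option X → ℝ≥0∞)
    (γ h : ℕ → ℝ≥0) (hg : ∀ y, g (some y) ≤ γ (rank F y)) (hh : Monotone h)
    (hstep : ∀ y, ∃ k r : ℝ≥0,
      UniformSearch F (findsol lam ε fun v => v < F y)
        (Finset.univ.filter fun x => F x < F y) k r ∧
      ∀ w : ℝ≥0, rank F y * w + r = 1 →
        c * (1 + k) + w * ∑ i ∈ Finset.range (rank F y), h i + r * γ (rank F y) ≤ h (rank F y))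
    (n : ℕ) (y : X) (hn : g none = 0 ∨ rank F y < n) :
    (minfindLoop lam ε n y).ev c F g ≤ h (rank F y) := by
  induction n generalizing y with
  | zero =>
    rcases hn with hn | hn
    · simp [minfindLoop, Prog.ev, hn]
    · omega
  | succ n ih =>
    obtain ⟨k, r, ⟨w, hw, he⟩, hb⟩ := hstep y
    rw [minfindLoop, Prog.ev, Prog.ev_bind, he]
    have hsum : ∑ x ∈ Finset.univ.filter (fun x => F x < F y), (minfindLoop lam ε n x).ev c F g ≤
        ((∑ i ∈ Finset.range (rank F y), h i : ℝ≥0) : ℝ≥0∞) := by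
      refine (Finset.sum_le_sum fun x hx => ih x ?_).trans ?_
      -- The rank drops in every successful pass, so the remaining passes still suffice.
      · refine hn.imp_right fun hn => ?_
        have := rank_lt_rank F (Finset.mem_filter.1 hx).2
        omega
      · exact_mod_cast sum_rank_le F h hh y
    calc _ ≤ (c : ℝ≥0∞) + (c * k + w * ((∑ i ∈ Finset.range (rank F y), h i : ℝ≥0) : ℝ≥0∞) +
            r * γ (rank F y)) := by
          simp only [Prog.ev]
          gcongr
          exact hg y
      _ = ((c * (1 + k) + w * ∑ i ∈ Finset.range (rank F y), h i + r * γ (rank F y) : ℝ≥0) :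
            ℝ≥0∞) := by
          push_cast
          ring
      _ ≤ _ := by exact_mod_cast hb w hw

theorem ev_minfind_le (F : X → V) (lam ε : ℝ) (n : ℕ) (c : ℝ≥0∞) (g : Option X → ℝ≥0∞)
    (b : ℝ≥0∞) (h : ∀ y, (minfindLoop lam ε n y).ev c F g ≤ b) :
    (minfind X V lam ε n).ev c F g ≤ b := by
  rw [minfind, Prog.ev]
  calc _ ≤ ∑' y, PMF.uniformOfFintype X y * b := by
        gcongr with y
        exact h y
    _ = b := by rw [ENNReal.tsum_mul_right, PMF.tsum_coe, one_mul]

/-- The probability that minfind does not return a minimizer is at most `ε`. -/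
theorem prob_minfind_le (F : X → V) (lam ε : ℝ) (n : ℕ) (h1 : 8 / 7 ≤ lam) (h2 : lam ≤ 1.31)
    (hε : 0 < ε) (hT : 1 ≤ bcwzBound X ε) (hn : Fintype.card X ≤ n) :
    (minfind X V lam ε n).prob F {r | ¬ ∃ x, r = some x ∧ ∀ z, F x ≤ F z} ≤
      ENNReal.ofReal ε := by
  classical
  rw [Prog.prob_eq_ev]
  set T := bcwzBound X ε with hTdef
  set h : ℕ → ℝ≥0 := fun t => if t ≤ T then 0 else ε.toNNReal with hh
  have hmono : Monotone h := by
    intro a b hab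
    simp only [hh]
    split_ifs with ha hb
    · exact le_rfl
    · exact bot_le
    · omega
    · exact le_rfl
  refine ev_minfind_le F lam ε n 0 _ _ fun y => ?_
  -- Zero weight on calls, and `g` the indicator of error. Running out of passes counts as an error,
  -- which is why `n` must be at least N.
  have key := ev_minfindLoop_le F lam ε 0
    (fun r => if r ∈ {r : Option X | ¬ ∃ x, r = some x ∧ ∀ z, F x ≤ F z} then 1 else 0)
    (fun t => if t = 0 then 0 else 1) h ?_ hmono ?_ n y
    (Or.inr ((rank_lt_card F y).trans_le hn))
  · rw [ENNReal.coe_zero] at key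
    refine (Eq.trans_le ?_ key).trans ?_
    · congr!
    · simp only [hh]
      split_ifs
      · simp
      · exact le_rfl
  · intro x
    by_cases hx : rank F x = 0
    · have := (rank_eq_zero_iff F x).1 hx
      simp [hx, this]
    · simp only [hx, if_false]
      split_ifs <;> simp
  · intro x
    obtain ⟨k, r, hu, -, -, hr0, hr⟩ := uniformSearch_findsol F (fun v => v < F x) lam ε h1 h2 hT
    refine ⟨k, r, hu, fun w hw => ?_⟩
    have hrank : (Finset.univ.filter fun z => F z < F x).card = rank F x := rfl
    rw [hrank, ← hTdef] at hr0 hr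
    rcases Nat.eq_zero_or_pos (rank F x) with h0 | h0
    · simp [h0]
    rcases le_or_gt (rank F x) T with ht | ht
    · have hz : ∑ i ∈ Finset.range (rank F x), h i = 0 :=
        Finset.sum_eq_zero fun i hi => if_pos ((Finset.mem_range.1 hi).le.trans ht)
      simp [hz, hr0 h0 ht]
    -- Write t for the rank. The T + 1 lowest ranks contribute no error, which leaves room for the
    -- failure probability ε/t of this pass: (t - T - 1)ε/t + ε/t ≤ ε.
    · have h3 := (hr ht).trans (three_quarters_pow_le hε (ht.trans (rank_lt_card F x)))
      have hsum := sum_range_ite_le T (rank F x) ht ε.toNNReal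
      rw [Real.coe_toNNReal _ hε.le] at hsum
      have ht' : (T : ℝ) + 1 ≤ rank F x := by exact_mod_cast ht
      have hpos : (0 : ℝ) < rank F x := by exact_mod_cast h0
      have hw' : (rank F x : ℝ) * w + r = 1 := by exact_mod_cast hw
      have hw1 : (rank F x : ℝ) * w ≤ 1 := by linarith [r.coe_nonneg]
      rw [← NNReal.coe_le_coe]
      simp only [zero_mul, zero_add, if_neg h0.ne', mul_one, hh, if_neg (not_le.2 ht)]
      rw [NNReal.coe_add, NNReal.coe_mul, hsum, Real.coe_toNNReal _ hε.le]
      refine le_of_mul_le_mul_right ?_ hpos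
      have h5 : (rank F x : ℝ) * w * ((rank F x - (T + 1)) * ε) ≤ (rank F x - (T + 1)) * ε :=
        mul_le_of_le_one_left (mul_nonneg (by linarith) hε.le) hw1
      have h6 : 0 ≤ (T : ℝ) * ε := by positivity
      linarith

theorem le_sum_inv_sqrt (t : ℕ) :
    2 * √((t : ℝ) + 1) - 2 ≤ ∑ i ∈ Finset.range t, 1 / √((i : ℝ) + 1) := by
  induction t with
  | zero => simp
  | succ t ih =>
    rw [Finset.sum_range_succ]
    have h0 : 0 < √((t : ℝ) + 1) := by positivity
    have h1 : √((t : ℝ) + 1) ^ 2 = t + 1 := Real.sq_sqrt (by positivity)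
    have h2 : √(((t + 1 : ℕ) : ℝ) + 1) ^ 2 = t + 2 := by
      rw [Real.sq_sqrt (by positivity)]
      push_cast
      ring
    have h3 : 2 * (√(((t + 1 : ℕ) : ℝ) + 1) - √((t : ℝ) + 1)) ≤ 1 / √((t : ℝ) + 1) := by
      rw [le_div_iff₀ h0]
      nlinarith [sq_nonneg (√(((t + 1 : ℕ) : ℝ) + 1) - √((t : ℝ) + 1))]
    linarith

/-- The cost recursion. With s = √(t+1), the average is at most 13 - 24/(s+1), while 1/√t ≤ 3/(2s).
What remains, 27/(2s) ≤ 24/(s+1), holds for s ≥ 9/7, and s ≥ √2. The constant 13 leaves 1 at t = 0,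
for the final pass. -/
theorem inv_sqrt_add_average_le (t : ℕ) (ht : 1 ≤ t) :
    1 / √(t : ℝ) + (∑ i ∈ Finset.range t, (13 - 12 / √((i : ℝ) + 1))) / t ≤
      13 - 12 / √((t : ℝ) + 1) := by
  have ht' : (1 : ℝ) ≤ t := by exact_mod_cast ht
  have hs : 0 < √(t : ℝ) := by positivity
  have hs2 : √(t : ℝ) ^ 2 = t := Real.sq_sqrt (by positivity)
  set s := √((t : ℝ) + 1) with hsdef
  have h2 : s ^ 2 = t + 1 := Real.sq_sqrt (by positivity)
  have h0 : 0 < s := by positivity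
  have h14 : 1.4 ≤ s := Real.le_sqrt_of_sq_le (by norm_num; linarith)
  have hsum : ∑ i ∈ Finset.range t, (13 - 12 / √((i : ℝ) + 1)) ≤ 13 * t - 12 * (2 * s - 2) := by
    have := le_sum_inv_sqrt t
    rw [Finset.sum_sub_distrib]
    have h3 : ∑ i ∈ Finset.range t, 12 / √((i : ℝ) + 1) =
        12 * ∑ i ∈ Finset.range t, 1 / √((i : ℝ) + 1) := by
      rw [Finset.mul_sum]
      exact Finset.sum_congr rfl fun i _ => by ring
    rw [h3]
    simp only [Finset.sum_const, Finset.card_range, nsmul_eq_mul]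
    linarith
  have h4 : 1 / √(t : ℝ) ≤ 3 / (2 * s) := by
    rw [div_le_div_iff₀ hs (by positivity)]
    nlinarith
  have h5 : (∑ i ∈ Finset.range t, (13 - 12 / √((i : ℝ) + 1))) / t ≤ 13 - 24 / (s + 1) := by
    rw [div_le_iff₀ (by linarith)]
    refine hsum.trans (le_of_eq ?_)
    have h6 : (t : ℝ) = (s - 1) * (s + 1) := by linarith
    rw [h6]
    field_simp
    ring
  have h6 : 3 / (2 * s) + 12 / s ≤ 24 / (s + 1) := by
    rw [show 3 / (2 * s) + 12 / s = 27 / (2 * s) by field_simp; norm_num,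
      div_le_div_iff₀ (by positivity) (by positivity)]
    linarith
  linarith

/-- The expected number of calls, in terms of the number `T` of `bcwz`. -/
theorem expectedCalls_minfind_le (F : X → V) (lam ε : ℝ) (n : ℕ) (h1 : 8 / 7 ≤ lam)
    (h2 : lam ≤ 1.31) (hT : 1 ≤ bcwzBound X ε) :
    (minfind X V lam ε n).expectedCalls F ≤
      ENNReal.ofReal (554 * (√(Fintype.card X : ℝ) * √(bcwzBound X ε : ℝ)) * 13) := by
  rw [Prog.expectedCalls_eq_ev]
  set T := bcwzBound X ε with hTdef
  set A := √(Fintype.card X : ℝ) * √(T : ℝ) with hA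
  have hsT : (1 : ℝ) ≤ √(T : ℝ) := Real.one_le_sqrt.2 (by exact_mod_cast hT)
  have hsN : (1 : ℝ) ≤ √(Fintype.card X : ℝ) :=
    Real.one_le_sqrt.2 (by exact_mod_cast Fintype.card_pos)
  have hAN : √(Fintype.card X : ℝ) ≤ A := le_mul_of_one_le_right (by linarith) hsT
  have hA0 : 0 < A := by positivity
  have hh0 : ∀ t : ℕ, 1 ≤ 13 - 12 / √((t : ℝ) + 1) := by
    intro t
    have : (1 : ℝ) ≤ √((t : ℝ) + 1) := Real.one_le_sqrt.2 (by simp)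
    have : 12 / √((t : ℝ) + 1) ≤ 12 := div_le_self (by norm_num) this
    linarith
  set h : ℕ → ℝ≥0 := fun t => (554 * A * (13 - 12 / √((t : ℝ) + 1))).toNNReal with hh
  have hcoe : ∀ t, (h t : ℝ) = 554 * A * (13 - 12 / √((t : ℝ) + 1)) := fun t =>
    Real.coe_toNNReal _ (mul_nonneg (by positivity) (by linarith [hh0 t]))
  have hmono : Monotone h := by
    intro a b hab
    rw [← NNReal.coe_le_coe, hcoe, hcoe]
    gcongr
  refine ev_minfind_le F lam ε n 1 _ _ fun y => ?_
  -- Only calls are counted, so stopping early costs nothing and `n` is arbitrary.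
  refine (ev_minfindLoop_le F lam ε 1 0 0 h (by simp) hmono (fun x => ?_) n y
    (Or.inl rfl)).trans ?_
  · obtain ⟨k, r, hu, hk0, hk, -, -⟩ := uniformSearch_findsol F (fun v => v < F x) lam ε h1 h2 hT
    refine ⟨k, r, hu, fun w hw => ?_⟩
    have hrank : (Finset.univ.filter fun z => F z < F x).card = rank F x := rfl
    rw [hrank, ← hTdef, ← hA] at hk0 hk
    have hw' : (rank F x : ℝ) * w + r = 1 := by exact_mod_cast hw
    rw [← NNReal.coe_le_coe]
    push_cast
    simp only [one_mul, Pi.zero_apply, mul_zero, add_zero, NNReal.coe_zero, hcoe]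
    rcases Nat.eq_zero_or_pos (rank F x) with h0 | h0
    · have := hk0 h0
      simp only [h0, Finset.range_zero, Finset.sum_empty, mul_zero, add_zero, Nat.cast_zero,
        zero_add, Real.sqrt_one, div_one]
      linarith
    · have ht : (1 : ℝ) ≤ rank F x := by exact_mod_cast h0
      have hst : 0 < √(rank F x : ℝ) := by positivity
      have hstN : √(rank F x : ℝ) ≤ √(Fintype.card X : ℝ) :=
        Real.sqrt_le_sqrt (by exact_mod_cast (rank_lt_card F x).le)
      -- 554 = 553 + 1: the evaluation of `F` at the current element is absorbed, since the rank is
      -- below N.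
      have hk1 : 1 + (k : ℝ) ≤ 554 * A * (1 / √(rank F x : ℝ)) := by
        have h3 : 1 ≤ A / √(rank F x : ℝ) := (one_le_div hst).2 (hstN.trans hAN)
        have h4 := hk h0
        rw [mul_div_assoc] at h4
        rw [mul_assoc, mul_one_div]
        linarith
      have hw1 : (w : ℝ) ≤ 1 / rank F x := by
        rw [le_div_iff₀ (by linarith)]
        linarith [r.coe_nonneg]
      have hs0 : 0 ≤ ∑ i ∈ Finset.range (rank F x), (13 - 12 / √((i : ℝ) + 1)) :=
        Finset.sum_nonneg fun i _ => by linarith [hh0 i]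
      calc 1 + (k : ℝ) + w * ∑ i ∈ Finset.range (rank F x), 554 * A * (13 - 12 / √((i : ℝ) + 1))
          = 1 + k + w * (554 * A * ∑ i ∈ Finset.range (rank F x), (13 - 12 / √((i : ℝ) + 1))) := by
            rw [← Finset.mul_sum]
        _ ≤ 554 * A * (1 / √(rank F x : ℝ)) + 1 / rank F x *
            (554 * A * ∑ i ∈ Finset.range (rank F x), (13 - 12 / √((i : ℝ) + 1))) := by
            gcongr
        _ = 554 * A * (1 / √(rank F x : ℝ) +
            (∑ i ∈ Finset.range (rank F x), (13 - 12 / √((i : ℝ) + 1))) / rank F x) := by ring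
        _ ≤ _ := by
            gcongr
            exact inv_sqrt_add_average_le _ h0
  · refine ENNReal.coe_le_coe.2 (Real.toNNReal_le_toNNReal ?_)
    have : 0 ≤ 12 / √((rank F y : ℝ) + 1) := by positivity
    gcongr
    linarith

end MinFind

end QMin

end

theorem theorem2 (ε₀ : ℝ) (hε₀ : ε₀ < 1) :
    ∃ C : ℝ, ∀ (X V : Type) [Fintype X] [Nonempty X] [Fintype V] [LinearOrder V]
      [AddCommGroup V] (F : X → V) (lam ε : ℝ) (n : ℕ),
      8 / 7 ≤ lam → lam ≤ 1.31 → 0 < ε → ε ≤ ε₀ → Fintype.card X ≤ n →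
        (QMin.minfind X V lam ε n).prob F {r | ¬ ∃ x, r = some x ∧ ∀ z, F x ≤ F z}
            ≤ ENNReal.ofReal ε ∧
        (QMin.minfind X V lam ε n).expectedCalls F
            ≤ ENNReal.ofReal (C * √((Fintype.card X : ℝ) * Real.logb 2 ε⁻¹)) := by
  refine ⟨554 * 13 * √(1 + 1 / Real.logb 2 ε₀⁻¹), ?_⟩
  intro X V _ _ _ _ _ F lam ε n h1 h2 hε hεε₀ hn
  have hε₀0 : 0 < ε₀ := hε.trans_le hεε₀
  have hl₀ : 0 < Real.logb 2 ε₀⁻¹ :=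
    Real.logb_pos (by norm_num) ((one_lt_inv₀ hε₀0).2 hε₀)
  have hl : Real.logb 2 ε₀⁻¹ ≤ Real.logb 2 ε⁻¹ :=
    Real.logb_le_logb_of_le (by norm_num) (by positivity) (inv_anti₀ hε hεε₀)
  have hT : 1 ≤ QMin.bcwzBound X ε :=
    le_min (Nat.one_le_ceil_iff.2 (hl₀.trans_le hl)) Fintype.card_pos
  refine ⟨QMin.prob_minfind_le F lam ε n h1 h2 hε hT hn,
    (QMin.expectedCalls_minfind_le F lam ε n h1 h2 hT).trans (ENNReal.ofReal_le_ofReal ?_)⟩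
  -- Rounding up adds at most 1, which is at most lg ε⁻¹ / lg ε₀⁻¹; this is the only dependence of
  -- the constant on ε₀.
  have hTl : (QMin.bcwzBound X ε : ℝ) ≤ (1 + 1 / Real.logb 2 ε₀⁻¹) * Real.logb 2 ε⁻¹ := by
    have h3 : (QMin.bcwzBound X ε : ℝ) ≤ ⌈Real.logb 2 ε⁻¹⌉₊ := Nat.cast_le.2 (min_le_left _ _)
    have h4 := Nat.ceil_lt_add_one (hl₀.le.trans hl)
    have h5 : 1 ≤ 1 / Real.logb 2 ε₀⁻¹ * Real.logb 2 ε⁻¹ := by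
      rw [one_div_mul_eq_div]
      exact (one_le_div hl₀).2 hl
    linarith
  calc 554 * (√(Fintype.card X : ℝ) * √(QMin.bcwzBound X ε : ℝ)) * 13
      ≤ 554 * (√(Fintype.card X : ℝ) *
          √((1 + 1 / Real.logb 2 ε₀⁻¹) * Real.logb 2 ε⁻¹)) * 13 := by gcongr
    _ = _ := by
      rw [Real.sqrt_mul (by positivity), Real.sqrt_mul (by positivity)]
      ring
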